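/- Let $G$ be a maximal planar graph, i.e. a finite simple graph that can be drawn in the plane without edges meeting outside common end points, such that joining any two distinct non-adjacent vertices by a new edge destroys planarity. A 3-clique of $G$ is a set $k$ of three mutually adjacent vertices (together with the edges between them, a cycle of length $3$); let $K$ be the set of all 3-cliques. Removing $k$ divides $G$ into two parts $S,S'$ if $S,S'$ are disjoint, $S\cup S'=V(G)\setminus k$, and every path of $G$ from a vertex of $S$ to a vertex of $S'$ contains a vertex of $k$. The 3-clique $k$ is a separating cycle of $G$ if such $S,S'$ exist which are both non-empty. For every $k\in K$ let $\{G^k_{in},G^k_{out}\}$ be two parts into which the removal of $k$ divides $G$, both non-empty if $k$ is separating (if $k$ is not separating, one of them is necessarily empty), named so that $|G^k_{in}|\le |G^k_{out}|$, where in case of equality the names interior ($G^k_{in}$) and exterior ($G^k_{out}$) are assigned arbitrarily. For $k,l\in K$ write $k\preceq_K l$ if $k\cup G^k_{in}\subseteq l\cup G^l_{in}$. Say that $l$ covers $k$ if $k\preceq_K l$, $k\neq l$, and there is no $m\in K\setminus\{k,l\}$ with $k\preceq_K m\preceq_K l$. The hierarchical graph $H$ is the directed graph with vertex set $K$ that has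 an edge from $k$ to $l$ exactly when $l$ covers $k$; the incoming neighbours of $l$ in $H$ are the $k\in K$ such that $H$ has an edge from $k$ to $l$. Then, for every such choice of interiors and exteriors and every 3-clique $k\in K$: $k$ is a separating cycle of $G$ if and only if the set of incoming neighbours of $k$ in $H$ is non-empty. -/

import Mathlib

namespace MaxPlanar

/-- The Euclidean plane. -/
abbrev Plane : Type := EuclideanSpace ℝ (Fin 2)

/-- `A` is a (polygonal) arc in the plane with endpoints `x` and `y`: a union of finitely many
straight line segments which is the image of `[0, 1]` under a continuous injective map
(equivalently, by compactness, homeomorphic to `[0, 1]`) taking `0` to `x` and `1` to `y`. -/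
def IsArc (x y : Plane) (A : Set Plane) : Prop :=
  (∃ γ : Path x y, Function.Injective γ ∧ Set.range γ = A) ∧
    ∃ T : Finset (Plane × Plane), A = ⋃ p ∈ T, segment ℝ p.1 p.2

/-- A drawing (embedding) of the simple graph `G` in the plane: distinct vertices are distinct
points, every edge is an arc joining its two ends, no arc passes through a vertex other than its
two ends, and two distinct edges meet at most in common ends. The value of `arc` at a pair which
is not an edge plays no role. -/
structure PlaneDrawing {V : Type*} (G : SimpleGraph V) where
  point : V → Plane
  arc : Sym2 V → Set Plane
  point_injective : Function.Injective point
  isArc : ∀ u v : V, G.Adj u v → IsArc (point u) (point v) (arc s(u, v))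
  end_of_mem_arc : ∀ e ∈ G.edgeSet, ∀ w : V, point w ∈ arc e → w ∈ e
  common_end_of_mem_arcs : ∀ e ∈ G.edgeSet, ∀ f ∈ G.edgeSet, e ≠ f →
    ∀ x : Plane, x ∈ arc e → x ∈ arc f → ∃ w : V, w ∈ e ∧ w ∈ f ∧ point w = x

/-- `G` is planar: it has a drawing in the plane. -/
def IsPlanar {V : Type*} (G : SimpleGraph V) : Prop :=
  Nonempty (PlaneDrawing G)

/-- `G` is maximal planar: it is planar, and joining any two distinct non-adjacent vertices by a
new edge destroys planarity. -/
def IsMaximalPlanar {V : Type*} (G : SimpleGraph V) : Prop :=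
  IsPlanar G ∧ ∀ u v : V, u ≠ v → ¬ G.Adj u v → ¬ IsPlanar (G ⊔ SimpleGraph.edge u v)

/-- Removing the vertices in `C` divides `G` into the two (possibly empty) parts spanned by the
vertex sets `S` and `S'`: these partition the remaining vertices, and every path of `G` from `S`
to `S'` contains a vertex of `C`. -/
structure Divides {V : Type*} [Fintype V] [DecidableEq V]
    (G : SimpleGraph V) (C S S' : Finset V) : Prop where
  disjoint : Disjoint S S'
  union_eq : S ∪ S' = Cᶜ
  path_meets : ∀ i ∈ S, ∀ j ∈ S', ∀ p : G.Walk i j, p.IsPath → ∃ c ∈ C, c ∈ p.support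

/-- A cycle of `G` with vertex set `C` is separating: it divides `G` into two non-empty parts. -/
def IsSeparating {V : Type*} [Fintype V] [DecidableEq V]
    (G : SimpleGraph V) (C : Finset V) : Prop :=
  ∃ S S' : Finset V, S.Nonempty ∧ S'.Nonempty ∧ Divides G C S S'

/-- The set `K` of 3-cliques of `G`; a 3-clique is given by its vertex set. -/
abbrev ThreeClique {V : Type*} (G : SimpleGraph V) : Type _ :=
  {k : Finset V // G.IsNClique 3 k}

/-- A choice of interior and exterior for every 3-clique `k` of `G`. They are the two parts into
which the removal of `k` divides `G`, both non-empty if `k` is separating (if `k` is not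
separating, one of them is necessarily empty), and the interior has at most as many vertices as
the exterior. If the two parts have the same number of vertices, either of them may be the
interior. The parts are subgraphs induced by `G`, so they are given by their vertex sets. -/
structure Orientation {V : Type*} [Fintype V] [DecidableEq V] (G : SimpleGraph V) where
  interior : ThreeClique G → Finset V
  exterior : ThreeClique G → Finset V
  divides : ∀ k : ThreeClique G, Divides G k.1 (interior k) (exterior k)
  nonempty_of_isSeparating : ∀ k : ThreeClique G, IsSeparating G k.1 →
    (interior k).Nonempty ∧ (exterior k).Nonempty
  card_le_card : ∀ k : ThreeClique G, (interior k).card ≤ (exterior k).card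

namespace Orientation

variable {V : Type*} [Fintype V] [DecidableEq V] {G : SimpleGraph V}

/-- The relation `k ≼ l` on 3-cliques: `k ∪ interior k` is contained in `l ∪ interior l`. Both
unions are induced subgraphs of `G`, so it is enough to compare vertex sets. -/
def Le (O : Orientation G) (k l : ThreeClique G) : Prop :=
  k.1 ∪ O.interior k ⊆ l.1 ∪ O.interior l

/-- `x` covers `y`: `y ≼ x`, `y ≠ x`, and no third 3-clique lies between them. -/
def Covers (O : Orientation G) (x y : ThreeClique G) : Prop :=
  O.Le y x ∧ y ≠ x ∧ ∀ z : ThreeClique G, O.Le y z → O.Le z x → z = y ∨ z = x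

/-- The hierarchical graph `H`: the directed graph on the set of 3-cliques with an edge from `k`
to `l` whenever `l` covers `k`. -/
def hierarchicalGraph (O : Orientation G) : Digraph (ThreeClique G) where
  Adj k l := O.Covers l k

end Orientation

/-- The incoming neighbours of the vertex `x` in a directed graph. -/
def incomingNeighbors {W : Type*} (H : Digraph W) (x : W) : Set W :=
  {y | H.Adj y x}

end MaxPlanar

/-! If `k` is not separating, its interior is empty, so `l ≼ k` forces `l ⊆ k` and hence `l = k`;
nothing is covered by `k`. If `k` is separating, it suffices to find some `l ≠ k` with `l ≼ k`:
among the finitely many such `l`, one with largest `l ∪ interior l` is covered by `k`, because `≼`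
is antisymmetric (`eq_of_le_of_card_le`). To find `l`, take an edge from a vertex of `k` into the
interior and complete it to a triangle. Its third vertex cannot lie in the exterior, so the triangle
lies in `k ∪ interior k`, and `le_of_subset` turns this inclusion of triangles into `≼`; the size
condition on interiors rules out the wrong side.

Two facts on maximal planar graphs carry this: cliques on at most two vertices do not separate
(`exists_adj_of_isClique`), and every edge lies in a triangle if there is a third vertex
(`exists_common_neighbor`). Both rest on `adj_of_mem_closure_face`: distinct vertices on one face
are adjacent, since otherwise an arc through the face could be added as a new edge. Hence parts with
no edge between them never share a face. On the other hand, `face_property_constant` carries a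
property of faces along a connected set of points, as long as at each point the touching faces agree
on it. Suitable connected sets are the plane minus finitely many points and a small disc minus an
arc starting at its centre. Neither the Jordan curve theorem nor Euler's formula is used. -/

namespace MaxPlanar

/-! ### Polygonal arcs in open connected sets -/

/-- Simple polygonal chains: `SimpleChain x y A` says that `A` is the union of the consecutive
segments of a non-selfintersecting chain from `x` to `y`. -/
inductive SimpleChain : Plane → Plane → Set Plane → Prop
  | single {x y : Plane} : x ≠ y → SimpleChain x y (segment ℝ x y)
  | cons {x y z : Plane} {A : Set Plane} : x ≠ y → SimpleChain y z A →
      (∀ w ∈ segment ℝ x y, w ∈ A → w = y) → SimpleChain x z (segment ℝ x y ∪ A)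

namespace SimpleChain

variable {x y z : Plane} {A : Set Plane}

theorem left_mem (h : SimpleChain x y A) : x ∈ A := by
  cases h with
  | single => exact left_mem_segment ℝ _ _
  | cons => exact Or.inl (left_mem_segment ℝ _ _)

theorem isClosed (h : SimpleChain x y A) : IsClosed A := by
  have hs : ∀ a b : Plane, IsClosed (segment ℝ a b) := fun a b => by
    rw [segment_eq_image_lineMap]
    exact (isCompact_Icc.image AffineMap.lineMap_continuous).isClosed
  induction h with
  | single => exact hs _ _
  | cons _ _ _ ih => exact (hs _ _).union ih

theorem exists_subchain (h : SimpleChain x y A) {w : Plane} (hw : w ∈ A) (hwy : w ≠ y) :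
    ∃ B ⊆ A, SimpleChain w y B := by
  induction h with
  | @single x y hxy =>
    refine ⟨segment ℝ w y, ?_, single hwy⟩
    exact (convex_segment x y).segment_subset hw (right_mem_segment ℝ _ _)
  | @cons x y z A hxy hA hint ih =>
    by_cases hwA : w ∈ A
    · obtain ⟨B, hB, hc⟩ := ih hwA hwy
      exact ⟨B, hB.trans Set.subset_union_right, hc⟩
    · have hws : w ∈ segment ℝ x y := hw.resolve_right hwA
      have hsub : segment ℝ w y ⊆ segment ℝ x y :=
        (convex_segment x y).segment_subset hws (right_mem_segment ℝ _ _)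
      exact ⟨segment ℝ w y ∪ A, Set.union_subset_union_left _ hsub,
        cons (fun e => hwA (e ▸ hA.left_mem)) hA fun v hv => hint v (hsub hv)⟩

/-- Follow the segment from `x` until it first meets the chain, then continue along the chain from
that point. The part of the chain before it is discarded, so no self-intersection arises. -/
theorem exists_extend (h : SimpleChain y z A) (hxz : x ≠ z) :
    ∃ B ⊆ segment ℝ x y ∪ A, SimpleChain x z B := by
  let f : ℝ → Plane := AffineMap.lineMap x y
  have hf : Continuous f := AffineMap.lineMap_continuous
  have hseg : ∀ t ∈ Set.Icc (0 : ℝ) 1, f t ∈ segment ℝ x y := fun t ht => by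
    rw [segment_eq_image_lineMap]; exact ⟨t, ht, rfl⟩
  obtain ⟨t, ⟨ht, htA⟩, hmin⟩ := (isCompact_Icc.inter_right (h.isClosed.preimage hf) :
    IsCompact (Set.Icc (0 : ℝ) 1 ∩ f ⁻¹' A)).exists_isLeast
      ⟨1, by simp, by simpa [f] using h.left_mem⟩
  have hsub : segment ℝ x (f t) ⊆ segment ℝ x y :=
    (convex_segment x y).segment_subset (left_mem_segment ℝ _ _) (hseg t ht)
  have hfirst : ∀ w ∈ segment ℝ x (f t), w ∈ A → w = f t := by
    intro w hw hwA
    rw [segment_eq_image_lineMap] at hw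
    obtain ⟨s, hs, rfl⟩ := hw
    have e : AffineMap.lineMap x (f t) s = f (s * t) := by
      simp only [f, AffineMap.lineMap_apply, vsub_eq_sub, vadd_eq_add, add_sub_cancel_right,
        smul_smul]
    rw [e] at hwA ⊢
    have h1 : t ≤ s * t := hmin ⟨⟨mul_nonneg hs.1 ht.1, mul_le_one₀ hs.2 ht.1 ht.2⟩, hwA⟩
    have h2 : s * t ≤ t := mul_le_of_le_one_left ht.1 hs.2
    rw [le_antisymm h2 h1]
  by_cases hx : x = f t
  · obtain ⟨B, hB, hc⟩ := h.exists_subchain (w := x) (by rw [hx]; exact htA) hxz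
    exact ⟨B, hB.trans Set.subset_union_right, hc⟩
  by_cases hz : f t = z
  · rw [hz] at hx hsub
    exact ⟨_, hsub.trans Set.subset_union_left, single hx⟩
  obtain ⟨B, hB, hc⟩ := h.exists_subchain htA hz
  exact ⟨segment ℝ x (f t) ∪ B, Set.union_subset_union hsub hB,
    cons hx hc fun w hw hwB => hfirst w hw (hB hwB)⟩

end SimpleChain

theorem trans_injective {x y z : Plane} {γ : Path x y} {δ : Path y z}
    (hγ : Function.Injective γ) (hδ : Function.Injective δ)
    (h : ∀ w ∈ Set.range γ, w ∈ Set.range δ → w = y) : Function.Injective (γ.trans δ) := by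
  have key : ∀ s t : unitInterval, (s : ℝ) ≤ 1 / 2 → ¬ (t : ℝ) ≤ 1 / 2 →
      (γ.trans δ) s ≠ (γ.trans δ) t := by
    intro s t hs ht e
    rw [Path.trans_apply, Path.trans_apply, dif_pos hs, dif_neg ht] at e
    have e2 := h _ ⟨_, rfl⟩ ⟨_, e.symm⟩
    have := congrArg Subtype.val (hδ ((e.symm.trans e2).trans δ.source.symm))
    simp at this
    linarith
  intro s t e
  by_cases hs : (s : ℝ) ≤ 1 / 2 <;> by_cases ht : (t : ℝ) ≤ 1 / 2
  · rw [Path.trans_apply, Path.trans_apply, dif_pos hs, dif_pos ht] at e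
    have := congrArg Subtype.val (hγ e)
    simp at this
    exact Subtype.ext this
  · exact absurd e (key s t hs ht)
  · exact absurd e.symm (key t s ht hs)
  · rw [Path.trans_apply, Path.trans_apply, dif_neg hs, dif_neg ht] at e
    have := congrArg Subtype.val (hδ e)
    simp at this
    exact Subtype.ext this

theorem SimpleChain.isArc {x y : Plane} {A : Set Plane} (h : SimpleChain x y A) :
    IsArc x y A := by
  classical
  induction h with
  | @single x y h => exact ⟨⟨.segment x y, Path.segment_injective_of_ne h, Path.range_segment x y⟩, {(x, y)}, by simp⟩
  | @cons x y z A hxy hA hint ih =>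
    obtain ⟨⟨δ, hδ, rfl⟩, T, hT⟩ := ih
    refine ⟨⟨(Path.segment x y).trans δ, trans_injective (Path.segment_injective_of_ne hxy) hδ ?_,
      by rw [Path.trans_range, Path.range_segment]⟩, insert (x, y) T, by rw [hT]; simp⟩
    rwa [Path.range_segment]

/-- Being joined to `r` by a simple chain that stays in `U` except at `r` is a locally constant
property of points of `U`, because balls are convex and chains can be extended by a segment. It
holds at `q`, hence at `p`, and one more extension reaches `s`. -/
theorem exists_isArc_of_isOpen {U : Set Plane} (hU : IsOpen U) (hc : IsPreconnected U)
    {s r p q : Plane} (hr : r ∉ U) (hsr : s ≠ r) (hp : p ∈ U) (hq : q ∈ U)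
    (hsp : ∀ w ∈ segment ℝ s p, w ≠ s → w ∈ U) (hrq : ∀ w ∈ segment ℝ r q, w ≠ r → w ∈ U) :
    ∃ A, IsArc s r A ∧ ∀ w ∈ A, w ∈ U ∨ w = s ∨ w = r := by
  let P : Plane → Prop := fun x => ∃ A, SimpleChain x r A ∧ ∀ w ∈ A, w ∈ U ∨ w = r
  have hne : ∀ x ∈ U, x ≠ r := fun x hx e => hr (e ▸ hx)
  have step : ∀ x y, x ∈ U → y ∈ U → segment ℝ x y ⊆ U → P y → P x := by
    rintro x y hx hy hxy ⟨A, hA, hAU⟩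
    obtain ⟨B, hB, hBc⟩ := hA.exists_extend (hne x hx)
    refine ⟨B, hBc, fun w hw => ?_⟩
    rcases hB hw with h | h
    · exact Or.inl (hxy h)
    · exact hAU w h
  have hPq : P q := by
    refine ⟨_, SimpleChain.single (hne q hq), fun w hw => ?_⟩
    by_cases h : w = r
    · exact Or.inr h
    · rw [segment_symm] at hw
      exact Or.inl (hrq w hw h)
  have hloc : ∀ x ∈ U, ∃ ε > 0, Metric.ball x ε ⊆ U ∧ ∀ y ∈ Metric.ball x ε, (P y ↔ P x) := by
    intro x hx
    obtain ⟨ε, hε, hb⟩ := Metric.isOpen_iff.1 hU x hx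
    refine ⟨ε, hε, hb, fun y hy => ?_⟩
    have h1 : segment ℝ x y ⊆ U :=
      ((convex_ball x ε).segment_subset (Metric.mem_ball_self hε) hy).trans hb
    exact ⟨step x y hx (hb hy) h1, step y x (hb hy) hx (by rwa [segment_symm])⟩
  have hPp : P p := by
    by_contra hn
    have o1 : IsOpen {x | x ∈ U ∧ P x} := Metric.isOpen_iff.2 fun x hx => by
      obtain ⟨ε, hε, hb, h⟩ := hloc x hx.1
      exact ⟨ε, hε, fun y hy => ⟨hb hy, (h y hy).2 hx.2⟩⟩
    have o2 : IsOpen {x | x ∈ U ∧ ¬ P x} := Metric.isOpen_iff.2 fun x hx => by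
      obtain ⟨ε, hε, hb, h⟩ := hloc x hx.1
      exact ⟨ε, hε, fun y hy => ⟨hb hy, fun h' => hx.2 ((h y hy).1 h')⟩⟩
    obtain ⟨x, -, h1, h2⟩ := hc _ _ o1 o2 (fun x hx => by
      by_cases h : P x
      · exact Or.inl ⟨hx, h⟩
      · exact Or.inr ⟨hx, h⟩) ⟨q, hq, hq, hPq⟩ ⟨p, hp, hp, hn⟩
    exact h2.2 h1.2
  obtain ⟨A, hA, hAU⟩ := hPp
  obtain ⟨B, hB, hBc⟩ := hA.exists_extend hsr
  refine ⟨B, hBc.isArc, fun w hw => ?_⟩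
  rcases hB hw with h | h
  · by_cases e : w = s
    · exact Or.inr (Or.inl e)
    · exact Or.inl (hsp w h e)
  · exact (hAU w h).imp_right Or.inr

end MaxPlanar

namespace MaxPlanar

/-! ### Polygonal sets and their faces -/

open Metric Set AffineMap

theorem isClosed_segment (a b : Plane) : IsClosed (segment ℝ a b) := by
  rw [segment_eq_image_lineMap]
  exact (isCompact_Icc.image lineMap_continuous).isClosed

/-- A set is polygonal if it is a union of finitely many segments. -/
def IsPolygonal (X : Set Plane) : Prop :=
  ∃ T : Finset (Plane × Plane), X = ⋃ p ∈ T, segment ℝ p.1 p.2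

namespace IsPolygonal

variable {X Y : Set Plane}

theorem union (hX : IsPolygonal X) (hY : IsPolygonal Y) : IsPolygonal (X ∪ Y) := by
  classical
  obtain ⟨S, rfl⟩ := hX
  obtain ⟨T, rfl⟩ := hY
  exact ⟨S ∪ T, by rw [Finset.set_biUnion_union]⟩

theorem iUnion {ι : Type*} [Finite ι] {X : ι → Set Plane} (h : ∀ i, IsPolygonal (X i)) :
    IsPolygonal (⋃ i, X i) := by
  classical
  have := Fintype.ofFinite ι
  choose T hT using h
  refine ⟨Finset.univ.biUnion T, ?_⟩
  rw [Finset.set_biUnion_biUnion]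
  simp [← hT]

theorem isClosed (hX : IsPolygonal X) : IsClosed X := by
  obtain ⟨T, rfl⟩ := hX
  exact T.finite_toSet.isClosed_biUnion fun p _ => isClosed_segment _ _

theorem dense_compl (hX : IsPolygonal X) : Dense Xᶜ := by
  obtain ⟨T, rfl⟩ := hX
  rw [← interior_eq_empty_iff_dense_compl]
  have h0 : MeasureTheory.volume (⋃ p ∈ T, segment ℝ p.1 p.2 : Set Plane) = 0 := by
    refine (MeasureTheory.measure_biUnion_null_iff T.countable_toSet).2 fun p _ => ?_
    have hsub : segment ℝ p.1 p.2 ⊆ (line[ℝ, p.1, p.2] : Set Plane) := by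
      rw [← convexHull_pair]; exact convexHull_subset_affineSpan _
    refine MeasureTheory.measure_mono_null hsub
      (MeasureTheory.Measure.addHaar_affineSubspace _ _ fun htop => ?_)
    have : Module.finrank ℝ (vectorSpan ℝ ({p.1, p.2} : Set Plane)) ≤ 1 := by
      exact collinear_iff_finrank_le_one.1 (collinear_pair ℝ _ _)
    rw [← direction_affineSpan, htop, AffineSubspace.direction_top, finrank_top,
      finrank_euclideanSpace_fin] at this
    omega
  by_contra hne
  exact (isOpen_interior.measure_pos MeasureTheory.volume (nonempty_iff_ne_empty.2 hne)).ne'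
    (MeasureTheory.measure_mono_null interior_subset h0)

end IsPolygonal

/-- Near any point `p` a segment looks like a cone with apex `p` (possibly empty, or only the apex).
This conical structure is what makes faces of polygonal sets easy to control locally. -/
theorem exists_ball_mem_segment_of_lineMap_mem (u v p : Plane) :
    ∃ ε > 0, ∀ z ∈ ball p ε, ∀ t ∈ Ioc (0 : ℝ) 1,
      lineMap p z t ∈ segment ℝ u v → z ∈ segment ℝ u v := by
  by_cases hp : p ∈ segment ℝ u v
  · by_cases huv : u = v
    · subst huv
      rw [segment_same, mem_singleton_iff] at hp
      subst hp
      refine ⟨1, one_pos, fun z _ t ht h => ?_⟩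
      rw [segment_same, mem_singleton_iff] at h ⊢
      rw [lineMap_eq_left_iff] at h
      exact (h.resolve_right ht.1.ne').symm
    · rw [segment_eq_image_lineMap] at hp ⊢
      obtain ⟨σ, hσ, rfl⟩ := hp
      have hd : 0 < dist u v := dist_pos.2 huv
      -- `δ` is at most the parameter distance from `p` to each end of the segment; an end that
      -- equals `p` imposes no bound and contributes the default value 1.
      obtain ⟨δ, hδ, h0, h1⟩ : ∃ δ > 0, (σ ≠ 0 → δ ≤ σ) ∧ (σ ≠ 1 → δ ≤ 1 - σ) := by
        refine ⟨min (if σ = 0 then 1 else σ) (if σ = 1 then 1 else 1 - σ), ?_, ?_, ?_⟩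
        · have h0 := hσ.1
          have h1 := hσ.2
          refine lt_min ?_ ?_ <;> split_ifs with h
          · exact one_pos
          · exact lt_of_le_of_ne h0 (Ne.symm h)
          · exact one_pos
          · exact sub_pos.2 (lt_of_le_of_ne h1 h)
        · intro h; refine (min_le_left _ _).trans ?_; rw [if_neg h]
        · intro h; refine (min_le_right _ _).trans ?_; rw [if_neg h]
      refine ⟨δ * dist u v, by positivity, ?_⟩
      rintro z hz t ht ⟨ρ, hρ, e⟩
      have ez : z = lineMap u v (σ + (ρ - σ) / t) := by
        have e' : (lineMap u v σ : Plane) + t • (z - lineMap u v σ) = lineMap u v ρ := by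
          rw [e, lineMap_apply _ z]; simp [add_comm]
        have : t • (z - lineMap u v σ) = (ρ - σ) • (v - u) := by
          rw [← add_right_inj (lineMap u v σ : Plane), e']
          simp only [lineMap_apply, vsub_eq_sub, vadd_eq_add]; module
        have h2 : z - lineMap u v σ = ((ρ - σ) / t) • (v - u) := by
          rw [div_eq_inv_mul, mul_smul, ← this, smul_smul, inv_mul_cancel₀ ht.1.ne', one_smul]
        rw [sub_eq_iff_eq_add] at h2
        rw [h2]
        simp only [lineMap_apply, vsub_eq_sub, vadd_eq_add]; module
      refine ⟨_, ?_, ez.symm⟩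
      rw [mem_ball, ez, dist_lineMap_lineMap, Real.dist_eq, add_sub_cancel_left] at hz
      have hlt := abs_lt.1 (lt_of_mul_lt_mul_right hz hd.le)
      constructor
      · by_cases h : σ = 0
        · subst h; have := div_nonneg hρ.1 ht.1.le; simpa using this
        · linarith [h0 h]
      · by_cases h : σ = 1
        · subst h
          have := div_nonpos_of_nonpos_of_nonneg (sub_nonpos.2 hρ.2) ht.1.le
          linarith
        · linarith [h1 h]
  · obtain ⟨ε, hε, hb⟩ := Metric.isOpen_iff.1 (isClosed_segment u v).isOpen_compl p hp
    refine ⟨ε, hε, fun z hz t ht h => absurd h (hb ?_)⟩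
    exact (convex_ball p ε).segment_subset (mem_ball_self hε) hz
      (by rw [segment_eq_image_lineMap]; exact ⟨t, ⟨ht.1.le, ht.2⟩, rfl⟩)

theorem IsPolygonal.exists_ball_lineMap_notMem {X : Set Plane} (hX : IsPolygonal X)
    (p : Plane) :
    ∃ ε > 0, ∀ z ∈ ball p ε, z ∉ X → ∀ t ∈ Ioc (0 : ℝ) 1, lineMap p z t ∉ X := by
  classical
  obtain ⟨T, rfl⟩ := hX
  induction T using Finset.induction_on with
  | empty => exact ⟨1, one_pos, by simp⟩
  | insert a s _ ih =>
    obtain ⟨ε, hε, h⟩ := ih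
    obtain ⟨δ, hδ, h'⟩ := exists_ball_mem_segment_of_lineMap_mem a.1 a.2 p
    refine ⟨min ε δ, lt_min hε hδ, fun z hz hzX t ht => ?_⟩
    rw [Finset.set_biUnion_insert, mem_union, not_or] at hzX ⊢
    exact ⟨fun hm => hzX.1 (h' z (ball_subset_ball (min_le_right _ _) hz) t ht hm),
      h z (ball_subset_ball (min_le_left _ _) hz) hzX.2 t ht⟩

/-- The face of `X` containing the point `z ∉ X`. -/
def face (X : Set Plane) (z : Plane) : Set Plane := connectedComponentIn Xᶜ z

section Face

variable {X : Set Plane} {x y z : Plane}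

theorem face_subset : face X z ⊆ Xᶜ := connectedComponentIn_subset _ _

theorem face_eq (h : y ∈ face X z) : face X y = face X z := (connectedComponentIn_eq h).symm

theorem mem_face_self (h : z ∉ X) : z ∈ face X z := mem_connectedComponentIn h

theorem isPreconnected_face : IsPreconnected (face X z) := isPreconnected_connectedComponentIn

theorem isOpen_face (hX : IsClosed X) : IsOpen (face X z) := hX.isOpen_compl.connectedComponentIn

theorem subset_face {C : Set Plane} (hC : IsPreconnected C) (hCX : ∀ c ∈ C, c ∉ X)
    (hy : y ∈ C) (hyz : y ∈ face X z) : C ⊆ face X z :=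
  face_eq hyz ▸ hC.subset_connectedComponentIn hy hCX

theorem face_eq_of_mem_closure (hX : IsClosed X) (hx : x ∉ X) (h : x ∈ closure (face X z)) :
    face X x = face X z := by
  obtain ⟨y, hy, hyz⟩ := mem_closure_iff.1 h _ (isOpen_face hX) (mem_face_self hx)
  rw [← face_eq hy, face_eq hyz]

theorem isPreconnected_lineMap_image {s : Set ℝ} (hs : IsPreconnected s) (x y : Plane) :
    IsPreconnected (lineMap x y '' s) := hs.image _ lineMap_continuous.continuousOn

/-- By the conical structure at `x`, any point of the face close enough to `x` sees `x` along a
segment lying in the face except possibly at `x`. -/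
theorem IsPolygonal.exists_visible (hX : IsPolygonal X) (h : x ∈ closure (face X z)) {δ : ℝ}
    (hδ : 0 < δ) : ∃ q ∈ face X z, q ∈ ball x δ ∧
      ∀ t ∈ Ioc (0 : ℝ) 1, lineMap x q t ∈ face X z := by
  obtain ⟨ε, hε, hb⟩ := hX.exists_ball_lineMap_notMem x
  obtain ⟨q, hq, hqz⟩ := mem_closure_iff.1 h _ isOpen_ball (mem_ball_self (lt_min hε hδ))
  refine ⟨q, hqz, ball_subset_ball (min_le_right _ _) hq, ?_⟩
  have hsub := subset_face (isPreconnected_lineMap_image isPreconnected_Ioc x q) (X := X) (y := q)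
    (z := z) (by
      rintro _ ⟨t, ht, rfl⟩
      exact hb q (ball_subset_ball (min_le_left _ _) hq) (face_subset hqz) t ht)
    ⟨1, right_mem_Ioc.2 (zero_lt_one' ℝ), by simp⟩ hqz
  exact fun t ht => hsub ⟨t, ht, rfl⟩

/-- Shrinking radially towards `x` stays inside a face. This semicontinuity makes "all faces
touching this point have a given property" an open condition on the point. -/
theorem IsPolygonal.exists_ball_mem_closure_face (hX : IsPolygonal X) (x : Plane) :
    ∃ ε > 0, ∀ y ∈ ball x ε, ∀ z, y ∈ closure (face X z) → x ∈ closure (face X z) := by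
  obtain ⟨ε, hε, hb⟩ := hX.exists_ball_lineMap_notMem x
  refine ⟨ε, hε, fun y hy z hyz => ?_⟩
  obtain ⟨q, hq, hqz⟩ := mem_closure_iff.1 hyz _ isOpen_ball hy
  have hsub := subset_face (isPreconnected_lineMap_image isPreconnected_Ioc x q) (X := X) (y := q)
    (z := z) (by rintro _ ⟨t, ht, rfl⟩; exact hb q hq (face_subset hqz) t ht)
    ⟨1, right_mem_Ioc.2 (zero_lt_one' ℝ), by simp⟩ hqz
  refine closure_mono hsub ?_
  refine mem_closure_of_tendsto (f := fun t : ℝ => (lineMap x q t : Plane))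
    (b := nhdsWithin (0 : ℝ) (Ioi 0)) ?_ ?_
  · have : Filter.Tendsto (fun t : ℝ => (lineMap x q t : Plane)) (nhds 0)
        (nhds (lineMap x q (0 : ℝ))) := lineMap_continuous.tendsto 0
    rw [lineMap_apply_zero] at this
    exact this.mono_left nhdsWithin_le_nhds
  · filter_upwards [Ioc_mem_nhdsGT (zero_lt_one' ℝ)] with t ht using ⟨t, ht, rfl⟩

theorem IsPolygonal.exists_mem_closure_face (hX : IsPolygonal X) (x : Plane) :
    ∃ z, z ∉ X ∧ x ∈ closure (face X z) := by
  obtain ⟨ε, hε, hb⟩ := hX.exists_ball_mem_closure_face x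
  obtain ⟨z, hz, hzX⟩ := hX.dense_compl.exists_mem_open isOpen_ball ⟨x, mem_ball_self hε⟩
  exact ⟨z, hz, hb z hzX z (subset_closure (mem_face_self hz))⟩

theorem mem_closure_face_of_lineMap {w : Plane} (hw : w ∈ face X z)
    (h : ∀ t ∈ Ico (0 : ℝ) 1, lineMap w y t ∉ X) : y ∈ closure (face X z) := by
  have hsub := subset_face (isPreconnected_lineMap_image isPreconnected_Ico w y) (X := X) (y := w)
    (z := z) (by rintro _ ⟨t, ht, rfl⟩; exact h t ht) ⟨0, by simp, by simp⟩ hw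
  refine closure_mono hsub ?_
  refine mem_closure_of_tendsto (f := fun t : ℝ => (lineMap w y t : Plane))
    (b := nhdsWithin (1 : ℝ) (Iio 1)) ?_ ?_
  · have : Filter.Tendsto (fun t : ℝ => (lineMap w y t : Plane)) (nhds 1)
        (nhds (lineMap w y (1 : ℝ))) := lineMap_continuous.tendsto 1
    rw [lineMap_apply_one] at this
    exact this.mono_left nhdsWithin_le_nhds
  · filter_upwards [Ico_mem_nhdsLT (zero_lt_one' ℝ)] with t ht using ⟨t, ht, rfl⟩

/-- A property of faces which at every point of a connected set `Q` holds for all or for none of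
the faces touching that point holds for all or for none of the faces touching `Q`. -/
theorem IsPolygonal.face_property_constant (hX : IsPolygonal X) {Q : Set Plane}
    (hQ : IsPreconnected Q) (τ : Plane → Prop) (hτ : ∀ y z, face X y = face X z → τ y → τ z)
    (hloc : ∀ x ∈ Q, x ∈ X → (∀ z ∉ X, x ∈ closure (face X z) → τ z) ∨
      ∀ z ∉ X, x ∈ closure (face X z) → ¬ τ z)
    {x y z z' : Plane} (hx : x ∈ Q) (hy : y ∈ Q) (hz : z ∉ X) (hz' : z' ∉ X)
    (hxz : x ∈ closure (face X z)) (hyz : y ∈ closure (face X z')) (h : τ z) : τ z' := by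
  have hloc' : ∀ x ∈ Q, (∀ z ∉ X, x ∈ closure (face X z) → τ z) ∨
      ∀ z ∉ X, x ∈ closure (face X z) → ¬ τ z := by
    intro x hx
    by_cases hxX : x ∈ X
    · exact hloc x hx hxX
    · by_cases hτx : τ x
      · exact Or.inl fun z _ hxz => hτ _ _ (face_eq_of_mem_closure hX.isClosed hxX hxz) hτx
      · exact Or.inr fun z _ hxz hτz =>
          hτx (hτ _ _ (face_eq_of_mem_closure hX.isClosed hxX hxz).symm hτz)
  have ho : ∀ σ : Plane → Prop, IsOpen {x | ∀ z ∉ X, x ∈ closure (face X z) → σ z} := by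
    intro σ
    refine Metric.isOpen_iff.2 fun x hx => ?_
    obtain ⟨ε, hε, hb⟩ := hX.exists_ball_mem_closure_face x
    exact ⟨ε, hε, fun y hy z hz hyz => hx z hz (hb y hy z hyz)⟩
  -- The two open conditions "all touching faces satisfy `τ`" and "none does" cover `Q`, so by
  -- connectedness they would hold together at some point; but every point is touched by a face.
  by_contra hn
  obtain ⟨w, -, h1, h2⟩ := hQ _ _ (ho τ) (ho fun z => ¬ τ z) hloc'
    ⟨x, hx, (hloc' x hx).resolve_right fun h' => h' z hz hxz h⟩
    ⟨y, hy, (hloc' y hy).resolve_left fun h' => hn (h' z' hz' hyz)⟩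
  obtain ⟨v, hv, hwv⟩ := hX.exists_mem_closure_face w
  exact h2 v hv hwv (h1 v hv hwv)

end Face

end MaxPlanar

namespace MaxPlanar

/-! ### Local pictures: rays in a ball, straight pieces of arcs -/

open Metric Set AffineMap

/-- Near a point `p` where `X` consists of two distinct rays, every face which comes close to `p`
touches both rays. -/
theorem mem_closure_face_of_two_rays {X : Set Plane} {p d e : Plane} {r α : ℝ}
    (hde : ¬ SameRay ℝ d e)
    (hX : ∀ x ∈ ball p r, x ∈ X ↔ ∃ c ≥ (0 : ℝ), x = p + c • d ∨ x = p + c • e)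
    {z : Plane} (hz : z ∈ ball p r) (hzX : z ∉ X) (hα : 0 < α) (hy : p + α • d ∈ ball p r) :
    p + α • d ∈ closure (face X z) := by
  have hr : 0 < r := pos_of_mem_ball hz
  have hball : ∀ {x y : Plane}, x ∈ ball p r → y ∈ ball p r → ∀ t ∈ Icc (0 : ℝ) 1,
      lineMap x y t ∈ ball p r := fun hx hy t ht =>
    (convex_ball p r).segment_subset hx hy (by rw [segment_eq_image_lineMap]; exact ⟨t, ht, rfl⟩)
  by_cases hA : ∀ t ∈ Ico (0 : ℝ) 1, lineMap z (p + α • d) t ∉ X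
  · exact mem_closure_face_of_lineMap (mem_face_self hzX) hA
  push Not at hA
  obtain ⟨t, ht, htX⟩ := hA
  have ht1 : 0 < 1 - t := sub_pos.2 ht.2
  rw [hX _ (hball hz hy t ⟨ht.1, ht.2.le⟩)] at htX
  rw [hX z hz] at hzX
  push Not at hzX
  have he : lineMap z (p + α • d) t = p + ((1 - t) • (z - p) + (t * α) • d) := by
    simp only [lineMap_apply, vsub_eq_sub, vadd_eq_add]; module
  rw [he] at htX
  -- If the direct segment from `z` to the target hits one of the rays, then `z` has a negative
  -- `d`-coordinate and a nonnegative `e`-coordinate.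
  obtain ⟨a, b, ha, hb, hzab⟩ : ∃ a b : ℝ, 0 < a ∧ 0 ≤ b ∧ z = p + (b • e - a • d) := by
    obtain ⟨c, hc, h | h⟩ := htX
    · have h1 : (1 - t) • (z - p) = (c - t * α) • d := by
        rw [add_right_inj] at h
        rw [sub_smul _ _ d, ← h]; abel
      have h2 : z = p + ((c - t * α) / (1 - t)) • d := by
        rw [div_eq_inv_mul, mul_smul, ← h1, smul_smul, inv_mul_cancel₀ ht1.ne']; simp
      refine ⟨-((c - t * α) / (1 - t)), 0, ?_, le_rfl, by rw [h2]; module⟩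
      by_contra hn
      exact (hzX _ (by linarith)).1 h2
    · have h1 : (1 - t) • (z - p) = c • e - (t * α) • d := by
        rw [add_right_inj] at h
        rw [← h]; abel
      have h2 : z = p + ((c / (1 - t)) • e - (t * α / (1 - t)) • d) := by
        rw [div_eq_inv_mul, div_eq_inv_mul, mul_smul, mul_smul, ← smul_sub, ← h1, smul_smul,
          inv_mul_cancel₀ ht1.ne']; simp
      have h3 : 0 ≤ t * α / (1 - t) := div_nonneg (mul_nonneg ht.1 hα.le) ht1.le
      refine ⟨_, _, lt_of_le_of_ne h3 fun h4 => ?_, div_nonneg hc ht1.le, h2⟩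
      rw [← h4] at h2
      exact (hzX _ (div_nonneg hc ht1.le)).2 (by rw [h2]; module)
  have hli : LinearIndependent ℝ ![d, e] := by
    by_contra hn
    have hneg := (sameRay_or_sameRay_neg_iff_not_linearIndependent.2 hn).resolve_left hde
    have hd0 : d ≠ 0 := fun h => hde (h ▸ SameRay.zero_left _)
    have he0 : -e ≠ 0 := fun h => hde (neg_eq_zero.1 h ▸ SameRay.zero_right _)
    obtain ⟨μ, hμ, h⟩ := hneg.exists_pos_right hd0 he0
    refine (hzX (b + a * μ) (by positivity)).2 ?_
    rw [hzab, h]; module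
  rw [LinearIndependent.pair_iff] at hli
  -- Detour through a point in the sector opposite to both rays: on the way there from `z` the
  -- `d`-coordinate stays negative, and on the way from there to the target the `e`-coordinate is
  -- negative until the end.
  obtain ⟨η, hη, hw⟩ : ∃ η > (0 : ℝ), p + (-η) • (d + e) ∈ ball p r := by
    have : Filter.Tendsto (fun η : ℝ => p + (-η) • (d + e)) (nhdsWithin 0 (Ioi 0)) (nhds p) := by
      have hc : Continuous fun η : ℝ => p + (-η) • (d + e) := by fun_prop
      simpa using (hc.tendsto 0).mono_left nhdsWithin_le_nhds
    obtain ⟨η, h1, h2⟩ := ((this.eventually (ball_mem_nhds p hr)).and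
      self_mem_nhdsWithin).exists
    exact ⟨η, h2, h1⟩
  have hcoef : ∀ {s t : ℝ}, p + (s • d + t • e) ∈ ball p r →
      (s < 0 ∨ t ≠ 0) → (t < 0 ∨ s ≠ 0) → p + (s • d + t • e) ∉ X := by
    intro s t hb hs ht hx
    rw [hX _ hb] at hx
    obtain ⟨c, hc, h | h⟩ := hx
    · obtain ⟨h1, h2⟩ := hli (s - c) t (by
        rw [add_right_inj, ← sub_eq_zero] at h; rw [← h]; module)
      rcases hs with hs | hs
      · linarith
      · exact hs h2
    · obtain ⟨h1, h2⟩ := hli s (t - c) (by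
        rw [add_right_inj, ← sub_eq_zero] at h; rw [← h]; module)
      rcases ht with ht | ht
      · linarith
      · exact ht h1
  have hwX : p + (-η) • (d + e) ∈ face X z := by
    refine subset_face (isPreconnected_lineMap_image isPreconnected_Icc z (p + (-η) • (d + e)))
      ?_ ⟨0, left_mem_Icc.2 zero_le_one, by simp⟩ (mem_face_self ?_)
      ⟨1, right_mem_Icc.2 zero_le_one, by simp⟩
    · rintro _ ⟨s, hs, rfl⟩
      have hb' := hball hz hw s hs
      have e1 : lineMap z (p + (-η) • (d + e)) s =
          p + ((-((1 - s) * a + s * η)) • d + ((1 - s) * b - s * η) • e) := by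
        rw [hzab]; simp only [lineMap_apply, vsub_eq_sub, vadd_eq_add]; module
      have h1 : 0 < (1 - s) * a + s * η := by
        rcases hs.1.eq_or_lt with rfl | h0
        · simpa using ha
        · exact add_pos_of_nonneg_of_pos (mul_nonneg (sub_nonneg.2 hs.2) ha.le) (mul_pos h0 hη)
      rw [e1] at hb' ⊢
      exact hcoef hb' (Or.inl (neg_lt_zero.2 h1)) (Or.inr (neg_lt_zero.2 h1).ne)
    · rw [hX z hz]
      rintro ⟨c, hc, h | h⟩
      · exact (hzX c hc).1 h
      · exact (hzX c hc).2 h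
  refine mem_closure_face_of_lineMap hwX fun s hs => ?_
  have hb' := hball hw hy s ⟨hs.1, hs.2.le⟩
  have e1 : lineMap (p + (-η) • (d + e)) (p + α • d) s =
      p + ((s * α - (1 - s) * η) • d + (-((1 - s) * η)) • e) := by
    simp only [lineMap_apply, vsub_eq_sub, vadd_eq_add]; module
  have h1 : 0 < (1 - s) * η := mul_pos (sub_pos.2 hs.2) hη
  rw [e1] at hb' ⊢
  exact hcoef hb' (Or.inr (neg_lt_zero.2 h1).ne) (Or.inl (neg_lt_zero.2 h1))

/-- The ball without the ray is star-shaped about any of its points on the opposite ray. -/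
theorem isPreconnected_ball_diff_ray {a d : Plane} {r : ℝ} (hd : d ≠ 0) :
    IsPreconnected (ball a r \ {x | ∃ c ≥ (0 : ℝ), x = a + c • d}) := by
  rcases le_or_gt r 0 with hr | hr
  · rw [ball_eq_empty.2 hr, empty_sdiff]; exact isPreconnected_empty
  obtain ⟨η, hη, hw⟩ : ∃ η > (0 : ℝ), a + (-η) • d ∈ ball a r := by
    have : Filter.Tendsto (fun η : ℝ => a + (-η) • d) (nhdsWithin 0 (Ioi 0)) (nhds a) := by
      have hc : Continuous fun η : ℝ => a + (-η) • d := by fun_prop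
      simpa using (hc.tendsto 0).mono_left nhdsWithin_le_nhds
    obtain ⟨η, h1, h2⟩ := ((this.eventually (ball_mem_nhds a hr)).and
      self_mem_nhdsWithin).exists
    exact ⟨η, h2, h1⟩
  have hmem : a + (-η) • d ∈ ball a r \ {x | ∃ c ≥ (0 : ℝ), x = a + c • d} := by
    refine ⟨hw, ?_⟩
    rintro ⟨c, hc, h⟩
    rw [add_right_inj] at h
    have := smul_left_injective ℝ hd h
    linarith
  refine (StarConvex.isPathConnected (a := a + (-η) • d) ?_ hmem).isConnected.isPreconnected
  rw [starConvex_iff_segment_subset]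
  intro x hx y hy
  refine ⟨(convex_ball a r).segment_subset hw hx.1 hy, ?_⟩
  rintro ⟨c, hc, rfl⟩
  rw [segment_eq_image_lineMap] at hy
  obtain ⟨t, ht, h⟩ := hy
  rcases ht.1.eq_or_lt with rfl | ht0
  · rw [lineMap_apply_zero] at h
    exact hmem.2 ⟨c, hc, h⟩
  · refine hx.2 ⟨(c + (1 - t) * η) / t, div_nonneg (add_nonneg hc (mul_nonneg (sub_nonneg.2 ht.2)
      hη.le)) ht0.le, ?_⟩
    have h1 : t • (x - a) = (c + (1 - t) * η) • d := by
      simp only [lineMap_apply, vsub_eq_sub, vadd_eq_add] at h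
      rw [← sub_eq_zero] at h ⊢
      rw [← h]; module
    rw [div_eq_inv_mul, mul_smul, ← h1, smul_smul, inv_mul_cancel₀ ht0.ne']; simp

/-- The inner product with `v - u` is injective on the segment and maps `C` onto an interval. -/
theorem segment_subset_of_isPreconnected {u v a b : Plane} {C : Set Plane}
    (hC : IsPreconnected C) (hCs : C ⊆ segment ℝ u v) (ha : a ∈ C) (hb : b ∈ C) :
    segment ℝ a b ⊆ C := by
  let φ : Plane → ℝ := fun x => inner ℝ (v - u) x
  have hφ : Continuous φ := by fun_prop
  have hinj : InjOn φ (segment ℝ u v) := by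
    intro x hx y hy hxy
    rw [segment_eq_image_lineMap] at hx hy
    obtain ⟨s, -, rfl⟩ := hx
    obtain ⟨t, -, rfl⟩ := hy
    have h2 : (s - t) * inner ℝ (v - u) (v - u) = 0 := by
      have h3 : φ (lineMap u v s) - φ (lineMap u v t) = 0 := sub_eq_zero.2 hxy
      simp only [φ, ← inner_sub_right] at h3
      rw [← h3, ← inner_smul_right]
      congr 1
      simp only [lineMap_apply, vsub_eq_sub, vadd_eq_add]; module
    rcases mul_eq_zero.1 h2 with h | h
    · rw [sub_eq_zero.1 h]
    · rw [inner_self_eq_zero] at h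
      rw [sub_eq_zero.1 h]; simp
  intro w hw
  have hws : w ∈ segment ℝ u v := (convex_segment u v).segment_subset (hCs ha) (hCs hb) hw
  have hconn : IsPreconnected (φ '' C) := hC.image _ hφ.continuousOn
  have h1 : φ w ∈ uIcc (φ a) (φ b) := by
    rw [← segment_eq_uIcc]
    obtain ⟨α, β, hα, hβ, h, rfl⟩ := hw
    refine ⟨α, β, hα, hβ, h, ?_⟩
    simp [φ, inner_add_right, inner_smul_right]
  obtain ⟨c, hc, hcw⟩ := hconn.ordConnected.uIcc_subset ⟨a, ha, rfl⟩ ⟨b, hb, rfl⟩ h1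
  rwa [← hinj (hCs hc) hws hcw]

/-- Of the finitely many segments, one contains `γ t` for parameters `t > s` arbitrarily close to
`s`, hence also `γ s`. As `γ` is an embedding, the preimage of this segment is an interval, so the
arc runs inside it from `s` to such a `t`. -/
theorem exists_image_Icc_eq_segment {x y : Plane} {γ : Path x y} (hγ : Function.Injective γ)
    (hp : IsPolygonal (range γ)) {s : unitInterval} (hs : s < 1) :
    ∃ t > s, γ '' Icc s t = segment ℝ (γ s) (γ t) := by
  obtain ⟨T, hT⟩ := hp
  have hemb : Topology.IsClosedEmbedding γ := γ.continuous.isClosedEmbedding hγ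
  have hpre : ∀ u v : Plane, segment ℝ u v ⊆ range γ →
      IsPreconnected (γ ⁻¹' segment ℝ u v) := by
    intro u v h
    rw [← hemb.isInducing.isPreconnected_image, image_preimage_eq_of_subset h]
    exact (convex_segment u v).isPreconnected
  have : (nhdsWithin s (Ioi s)).NeBot := nhdsGT_neBot_of_exists_gt ⟨1, hs⟩
  obtain ⟨p, hpT, hfreq⟩ : ∃ p ∈ T, ∃ᶠ t in nhdsWithin s (Ioi s), γ t ∈ segment ℝ p.1 p.2 := by
    by_contra hn
    push Not at hn
    obtain ⟨t, ht⟩ := ((Filter.eventually_all_finset T).2 hn).exists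
    have : γ t ∈ range γ := ⟨t, rfl⟩
    rw [hT, mem_iUnion₂] at this
    obtain ⟨q, hq, h⟩ := this
    exact ht q hq h
  have hsub : segment ℝ p.1 p.2 ⊆ range γ := by
    rw [hT]; exact subset_biUnion_of_mem (u := fun p : Plane × Plane => segment ℝ p.1 p.2) hpT
  have hs0 : γ s ∈ segment ℝ p.1 p.2 :=
    ((isClosed_segment p.1 p.2).preimage γ.continuous).mem_of_frequently_of_tendsto
      (hfreq.filter_mono nhdsWithin_le_nhds) Filter.tendsto_id
  obtain ⟨t, ht, hst⟩ := (hfreq.and_eventually self_mem_nhdsWithin).exists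
  have h1 : Icc s t ⊆ γ ⁻¹' segment ℝ p.1 p.2 := (hpre _ _ hsub).Icc_subset hs0 ht
  have h2 : segment ℝ (γ s) (γ t) ⊆ γ '' Icc s t := by
    refine segment_subset_of_isPreconnected (isPreconnected_Icc.image _ γ.continuous.continuousOn)
      (image_subset_iff.2 h1) ⟨s, ⟨le_rfl, le_of_lt hst⟩, rfl⟩ ⟨t, ⟨le_of_lt hst, le_rfl⟩, rfl⟩
  refine ⟨t, hst, subset_antisymm (image_subset_iff.2 ?_) h2⟩
  exact (hpre _ _ (h2.trans (image_subset_range _ _))).Icc_subset (left_mem_segment ℝ _ _)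
    (right_mem_segment ℝ _ _)

theorem exists_image_Icc_eq_segment_left {x y : Plane} {γ : Path x y}
    (hγ : Function.Injective γ) (hp : IsPolygonal (range γ)) {s : unitInterval} (hs : 0 < s) :
    ∃ t < s, γ '' Icc t s = segment ℝ (γ s) (γ t) := by
  have hinj : Function.Injective γ.symm := fun a b h =>
    unitInterval.symm_bijective.injective (hγ (by simpa [Path.symm_apply] using h))
  obtain ⟨t, ht, h⟩ := exists_image_Icc_eq_segment (s := unitInterval.symm s) hinj
    (by rwa [Path.symm_range]) (by
    rw [← unitInterval.symm_zero]; exact unitInterval.strictAnti_symm hs)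
  refine ⟨unitInterval.symm t, unitInterval.symm_symm s ▸ unitInterval.strictAnti_symm ht, ?_⟩
  simp only [Path.symm_apply, Function.comp_apply, unitInterval.symm_symm] at h
  rw [← h]
  ext w
  constructor
  · rintro ⟨a, ha, rfl⟩
    refine ⟨unitInterval.symm a, ⟨?_, ?_⟩, by simp⟩
    · simpa using ha.2
    · simpa [unitInterval.symm_le_comm] using ha.1
  · rintro ⟨a, ha, rfl⟩
    refine ⟨unitInterval.symm a, ⟨?_, ?_⟩, by simp⟩
    · simpa using ha.2
    · simpa [unitInterval.symm_le_comm] using ha.1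

end MaxPlanar

namespace MaxPlanar

/-! ### Faces along an arc -/

open Metric Set AffineMap

theorem IsArc.isPolygonal {x y : Plane} {A : Set Plane} (h : IsArc x y A) : IsPolygonal A := h.2

theorem mem_segment_of_mem_ball {p q : Plane} {r c : ℝ} (hr : r ≤ dist q p) (hc : 0 ≤ c)
    (h : p + c • (q - p) ∈ ball p r) : p + c • (q - p) ∈ segment ℝ p q := by
  rw [segment_eq_image_lineMap]
  refine ⟨c, ⟨hc, ?_⟩, by simp [lineMap_apply, add_comm]⟩
  rw [mem_ball, dist_eq_norm, add_sub_cancel_left, norm_smul, Real.norm_of_nonneg hc,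
    ← dist_eq_norm] at h
  by_contra hn
  have : dist q p ≤ c * dist q p := le_mul_of_one_le_left dist_nonneg (not_le.1 hn).le
  linarith

theorem exists_smul_of_mem_segment {p q w : Plane} (h : w ∈ segment ℝ p q) :
    ∃ c ≥ (0 : ℝ), w = p + c • (q - p) := by
  rw [segment_eq_image_lineMap] at h
  obtain ⟨t, ht, rfl⟩ := h
  exact ⟨t, ht.1, by simp [lineMap_apply, add_comm]⟩

/-- The arc starts with a straight piece and the compact remainder avoids `x`, so a small ball meets
the arc in a single radius. -/
theorem IsArc.exists_isPreconnected_ball_diff {x y : Plane} {A : Set Plane} (h : IsArc x y A) :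
    ∃ ε > 0, IsPreconnected (ball x ε \ A) := by
  have hA := h.isPolygonal
  obtain ⟨⟨γ, hγ, rfl⟩, -⟩ := h
  obtain ⟨t, ht, hseg⟩ := exists_image_Icc_eq_segment hγ hA (s := 0) zero_lt_one
  rw [γ.source] at hseg
  have hne : γ t ≠ x := fun e => ht.ne' (hγ (e.trans γ.source.symm))
  have hK : IsClosed (γ '' Icc t 1) := (isCompact_Icc.image γ.continuous).isClosed
  have hxK : x ∉ γ '' Icc t 1 := by
    rintro ⟨s, hs, e⟩
    exact (ht.trans_le hs.1).ne' (hγ (e.trans γ.source.symm))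
  obtain ⟨ε, hε, hb⟩ := Metric.isOpen_iff.1 hK.isOpen_compl x hxK
  refine ⟨min ε (dist (γ t) x), lt_min hε (dist_pos.2 hne), ?_⟩
  convert isPreconnected_ball_diff_ray (a := x) (r := min ε (dist (γ t) x)) (sub_ne_zero.2 hne)
    using 1
  ext w
  refine and_congr_right fun hw => not_congr ⟨?_, ?_⟩
  · rintro ⟨s, rfl⟩
    refine exists_smul_of_mem_segment (hseg ▸ ⟨s, ⟨s.2.1, ?_⟩, rfl⟩)
    by_contra hn
    exact hb (ball_subset_ball (min_le_left _ _) hw) ⟨s, ⟨(not_le.1 hn).le, s.2.2⟩, rfl⟩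
  · rintro ⟨c, hc, rfl⟩
    have h1 := mem_segment_of_mem_ball (min_le_right _ _) hc hw
    rw [← hseg] at h1
    exact image_subset_range _ _ h1

/-- Locally at an inner point, a face touching an arc touches the arc in a whole neighbourhood. -/
theorem eventually_mem_closure_face {x y : Plane} {γ : Path x y} (hγ : Function.Injective γ)
    (hp : IsPolygonal (range γ)) {Y : Set Plane} (hY : IsClosed Y) {s : unitInterval}
    (h0 : 0 < s) (h1 : s < 1) (hsY : γ s ∉ Y) {z : Plane}
    (hz : γ s ∈ closure (face (range γ ∪ Y) z)) :
    ∀ᶠ t in nhds s, γ t ∈ closure (face (range γ ∪ Y) z) := by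
  obtain ⟨a, ha, hsa⟩ := exists_image_Icc_eq_segment_left hγ hp h0
  obtain ⟨b, hb, hsb⟩ := exists_image_Icc_eq_segment hγ hp h1
  have hane : γ a ≠ γ s := fun e => ha.ne (hγ e)
  have hbne : γ b ≠ γ s := fun e => hb.ne' (hγ e)
  have hK : IsClosed (γ '' (Icc 0 a ∪ Icc b 1)) :=
    ((isCompact_Icc.union isCompact_Icc).image γ.continuous).isClosed
  have hsK : γ s ∉ γ '' (Icc 0 a ∪ Icc b 1) := by
    rintro ⟨t, ht, e⟩
    rw [hγ e] at ht
    rcases ht with ht | ht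
    · exact absurd ht.2 (not_le.2 ha)
    · exact absurd ht.1 (not_le.2 hb)
  obtain ⟨ε, hε, hball⟩ := Metric.isOpen_iff.1 (hK.union hY).isOpen_compl (γ s)
    (by rintro (h | h); exacts [hsK h, hsY h])
  obtain ⟨r, hr, hrε, hra, hrb⟩ : ∃ r > 0, r ≤ ε ∧ r ≤ dist (γ a) (γ s) ∧ r ≤ dist (γ b) (γ s) :=
    ⟨min ε (min (dist (γ a) (γ s)) (dist (γ b) (γ s))),
      lt_min hε (lt_min (dist_pos.2 hane) (dist_pos.2 hbne)), min_le_left _ _,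
      (min_le_right _ _).trans (min_le_left _ _), (min_le_right _ _).trans (min_le_right _ _)⟩
  have hray : ∀ t, a ≤ t → t ≤ b → ∃ c ≥ (0 : ℝ), γ t = γ s + c • (γ a - γ s) ∨
      γ t = γ s + c • (γ b - γ s) := by
    intro t hat htb
    rcases le_total t s with hts | hst
    · obtain ⟨c, hc, h⟩ := exists_smul_of_mem_segment (hsa.subset ⟨t, ⟨hat, hts⟩, rfl⟩)
      exact ⟨c, hc, Or.inl h⟩
    · obtain ⟨c, hc, h⟩ := exists_smul_of_mem_segment (hsb.subset ⟨t, ⟨hst, htb⟩, rfl⟩)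
      exact ⟨c, hc, Or.inr h⟩
  have hX : ∀ w ∈ ball (γ s) r, w ∈ range γ ∪ Y ↔ ∃ c ≥ (0 : ℝ), w = γ s + c • (γ a - γ s) ∨
      w = γ s + c • (γ b - γ s) := by
    intro w hw
    constructor
    · have hw' := hball (ball_subset_ball hrε hw)
      rintro (⟨t, rfl⟩ | h)
      · refine hray t ?_ ?_
        · by_contra hn
          exact hw' (Or.inl ⟨t, Or.inl ⟨t.2.1, (not_le.1 hn).le⟩, rfl⟩)
        · by_contra hn
          exact hw' (Or.inl ⟨t, Or.inr ⟨(not_le.1 hn).le, t.2.2⟩, rfl⟩)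
      · exact absurd (Or.inr h) hw'
    · rintro ⟨c, hc, rfl | rfl⟩
      · have := mem_segment_of_mem_ball hra hc hw
        rw [← hsa] at this
        exact Or.inl (image_subset_range _ _ this)
      · have := mem_segment_of_mem_ball hrb hc hw
        rw [← hsb] at this
        exact Or.inl (image_subset_range _ _ this)
  -- If the straight pieces before and after `s` had the same direction they would overlap,
  -- contradicting injectivity of `γ`.
  have hnot : ¬ SameRay ℝ (γ a - γ s) (γ b - γ s) := by
    intro hs
    have key : ∀ {u v : unitInterval} {c : ℝ}, 0 < c → c ≤ 1 →
        γ u - γ s = c • (γ v - γ s) → γ u ∈ segment ℝ (γ s) (γ v) := by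
      intro u v c hc hc1 h
      rw [segment_eq_image_lineMap]
      refine ⟨c, ⟨hc.le, hc1⟩, ?_⟩
      rw [lineMap_apply, vsub_eq_sub, vadd_eq_add, ← h, sub_add_cancel]
    obtain ⟨c, hc, h⟩ := hs.exists_pos_right (sub_ne_zero.2 hane) (sub_ne_zero.2 hbne)
    rcases le_total c 1 with hc1 | hc1
    · have := key hc hc1 h
      rw [← hsb] at this
      obtain ⟨t, ht, e⟩ := this
      rw [hγ e] at ht
      exact absurd ht.1 (not_le.2 ha)
    · have := key (inv_pos.2 hc) (inv_le_one_of_one_le₀ hc1)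
        (by rw [h, smul_smul, inv_mul_cancel₀ hc.ne', one_smul] :
          γ b - γ s = c⁻¹ • (γ a - γ s))
      rw [← hsa] at this
      obtain ⟨t, ht, e⟩ := this
      rw [hγ e] at ht
      exact absurd ht.2 (not_le.2 hb)
  obtain ⟨q, hq, hqz⟩ := mem_closure_iff.1 hz _ isOpen_ball (mem_ball_self hr)
  filter_upwards [Ioo_mem_nhds ha hb, γ.continuous.continuousAt (ball_mem_nhds _ hr)] with t ht hbt
  rw [mem_preimage] at hbt
  obtain ⟨c, hc, h⟩ := hray t ht.1.le ht.2.le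
  rcases hc.eq_or_lt with rfl | hc0
  · rw [zero_smul, zero_smul, add_zero, or_self] at h
    rwa [h]
  rw [← face_eq hqz]
  rcases h with h | h
  · rw [h] at hbt ⊢
    exact mem_closure_face_of_two_rays hnot hX hq (face_subset hqz) hc0 hbt
  · rw [h] at hbt ⊢
    refine mem_closure_face_of_two_rays (fun hs => hnot hs.symm) (fun w hw => ?_) hq
      (face_subset hqz) hc0 hbt
    rw [hX w hw]
    simp only [or_comm]

/-- A face touching an arc of the drawing at an inner point touches the whole arc. -/
theorem IsArc.subset_closure_face {x y : Plane} {A Y : Set Plane} (hA : IsArc x y A)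
    (hY : IsClosed Y) (hAY : ∀ w ∈ A, w ∈ Y → w = x ∨ w = y) {p z : Plane} (hp : p ∈ A)
    (hpx : p ≠ x) (hpy : p ≠ y) (h : p ∈ closure (face (A ∪ Y) z)) :
    A ⊆ closure (face (A ∪ Y) z) := by
  have hpoly := hA.isPolygonal
  obtain ⟨⟨γ, hγ, rfl⟩, -⟩ := hA
  have hclosed : IsClosed (γ ⁻¹' closure (face (range γ ∪ Y) z)) :=
    isClosed_closure.preimage γ.continuous
  have hsub : Ioo (0 : unitInterval) 1 ⊆ γ ⁻¹' closure (face (range γ ∪ Y) z) := by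
    by_contra hn
    obtain ⟨t, ht, htn⟩ := not_subset.1 hn
    obtain ⟨s, rfl⟩ := hp
    have hs : s ∈ Ioo (0 : unitInterval) 1 :=
      ⟨lt_of_le_of_ne s.2.1 fun e => hpx ((congrArg γ e.symm).trans γ.source),
        lt_of_le_of_ne s.2.2 fun e => hpy ((congrArg γ e).trans γ.target)⟩
    -- The inner parameters at which the face touches the arc form a closed set, open by
    -- `eventually_mem_closure_face`; being nonempty, it is the whole open interval. The ends follow
    -- by taking the closure.
    obtain ⟨w, hw, h1, h2⟩ := isPreconnected_Ioo (a := (0 : unitInterval)) (b := 1)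
      (interior (γ ⁻¹' closure (face (range γ ∪ Y) z)))
      (γ ⁻¹' closure (face (range γ ∪ Y) z))ᶜ isOpen_interior hclosed.isOpen_compl
      (fun v hv => by
        by_cases hvz : γ v ∈ closure (face (range γ ∪ Y) z)
        · refine Or.inl (mem_interior_iff_mem_nhds.2
            (eventually_mem_closure_face hγ hpoly hY hv.1 hv.2 (fun hvY => ?_) hvz))
          rcases hAY _ ⟨v, rfl⟩ hvY with e | e
          · exact hv.1.ne' (hγ (e.trans γ.source.symm))
          · exact hv.2.ne (hγ (e.trans γ.target.symm))
        · exact Or.inr hvz)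
      ⟨s, hs, mem_interior_iff_mem_nhds.2
        (eventually_mem_closure_face hγ hpoly hY hs.1 hs.2 (fun hvY => by
          rcases hAY _ ⟨s, rfl⟩ hvY with e | e
          exacts [hpx e, hpy e]) h)⟩
      ⟨t, ht, htn⟩
    exact h2 (interior_subset h1)
  have hall : closure (Ioo (0 : unitInterval) 1) ⊆ γ ⁻¹' closure (face (range γ ∪ Y) z) :=
    closure_minimal hsub hclosed
  rw [closure_Ioo zero_ne_one] at hall
  rintro _ ⟨t, rfl⟩
  exact hall ⟨t.2.1, t.2.2⟩

end MaxPlanar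

namespace MaxPlanar

/-! ### Plane drawings: adding an edge through a face -/

open Metric Set AffineMap

theorem IsArc.symm {x y : Plane} {A : Set Plane} (h : IsArc x y A) : IsArc y x A := by
  obtain ⟨⟨γ, hγ, rfl⟩, hT⟩ := h
  exact ⟨⟨γ.symm, fun a b hab => unitInterval.symm_bijective.injective
    (hγ (by simpa [Path.symm_apply] using hab)), Path.symm_range γ⟩, hT⟩

theorem IsArc.left_mem {x y : Plane} {A : Set Plane} (h : IsArc x y A) : x ∈ A := by
  obtain ⟨⟨γ, -, rfl⟩, -⟩ := h
  exact ⟨0, γ.source⟩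

theorem IsArc.exists_mem_ball {x y : Plane} {A : Set Plane} (h : IsArc x y A) {ε : ℝ}
    (hε : 0 < ε) : ∃ w ∈ A, w ∈ ball x ε ∧ w ≠ x ∧ w ≠ y := by
  obtain ⟨⟨γ, hγ, rfl⟩, -⟩ := h
  have : (nhdsWithin (0 : unitInterval) (Ioi 0)).NeBot := nhdsGT_neBot_of_exists_gt ⟨1, zero_lt_one⟩
  have h1 : ∀ᶠ t in nhdsWithin (0 : unitInterval) (Ioi 0), γ t ∈ ball x ε := by
    have h2 := γ.continuous.tendsto 0
    rw [γ.source] at h2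
    exact (h2.mono_left nhdsWithin_le_nhds).eventually (ball_mem_nhds x hε)
  obtain ⟨t, ht, h0⟩ := (h1.and (Ioo_mem_nhdsGT (zero_lt_one' unitInterval))).exists
  exact ⟨γ t, ⟨t, rfl⟩, ht, fun e => h0.1.ne' (hγ (e.trans γ.source.symm)),
    fun e => h0.2.ne (hγ (e.trans γ.target.symm))⟩

namespace PlaneDrawing

variable {V : Type*} {G : SimpleGraph V} (D : PlaneDrawing G)

/-- The set of all points of the drawing. -/
def carrier : Set Plane := (⋃ e : G.edgeSet, D.arc e) ∪ range D.point

theorem isPolygonal_arc {e : Sym2 V} (he : e ∈ G.edgeSet) : IsPolygonal (D.arc e) := by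
  induction e using Sym2.ind with
  | _ u v => exact (D.isArc u v he).isPolygonal

theorem isPolygonal_range_point [Finite V] : IsPolygonal (range D.point) := by
  rw [← iUnion_singleton_eq_range]
  exact IsPolygonal.iUnion fun v => ⟨{(D.point v, D.point v)}, by simp⟩

theorem isPolygonal_carrier [Finite V] : IsPolygonal D.carrier :=
  (IsPolygonal.iUnion fun e : G.edgeSet => D.isPolygonal_arc e.2).union D.isPolygonal_range_point

variable {D}

theorem point_mem_carrier (v : V) : D.point v ∈ D.carrier := Or.inr ⟨v, rfl⟩

theorem arc_subset_carrier {e : Sym2 V} (he : e ∈ G.edgeSet) : D.arc e ⊆ D.carrier :=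
  fun _ hx => Or.inl (mem_iUnion.2 ⟨⟨e, he⟩, hx⟩)

/-- The rest of the drawing, with all vertices, is a closed set meeting the edge only in its ends,
so `IsArc.subset_closure_face` applies. -/
theorem mem_closure_face_of_mem_arc [Finite V] {e : Sym2 V} (he : e ∈ G.edgeSet) {x z : Plane}
    (hx : x ∈ D.arc e) (hxv : x ∉ range D.point) (hz : x ∈ closure (face D.carrier z)) :
    ∀ v ∈ e, D.point v ∈ closure (face D.carrier z) := by
  induction e using Sym2.ind with
  | _ u v =>
    have harc := D.isArc u v he
    let Y : Set Plane := (⋃ f : {f : G.edgeSet // f.1 ≠ s(u, v)}, D.arc f.1) ∪ range D.point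
    have hY : IsPolygonal Y :=
      (IsPolygonal.iUnion fun f => D.isPolygonal_arc f.1.2).union D.isPolygonal_range_point
    have hc : D.carrier = D.arc s(u, v) ∪ Y := by
      ext w
      constructor
      · rintro (h | h)
        · obtain ⟨f, hf⟩ := mem_iUnion.1 h
          by_cases hfe : f.1 = s(u, v)
          · exact Or.inl (hfe ▸ hf)
          · exact Or.inr (Or.inl (mem_iUnion.2 ⟨⟨f, hfe⟩, hf⟩))
        · exact Or.inr (Or.inr h)
      · rintro (h | h | h)
        · exact arc_subset_carrier he h
        · obtain ⟨f, hf⟩ := mem_iUnion.1 h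
          exact arc_subset_carrier f.1.2 hf
        · exact Or.inr h
    have hend : ∀ w : V, w ∈ s(u, v) → D.point w = D.point u ∨ D.point w = D.point v := by
      intro w hw
      rcases Sym2.mem_iff.1 hw with rfl | rfl
      exacts [Or.inl rfl, Or.inr rfl]
    have key := harc.subset_closure_face hY.isClosed (fun w hw hwY => by
      rcases hwY with h | ⟨t, rfl⟩
      · obtain ⟨f, hf⟩ := mem_iUnion.1 h
        obtain ⟨t, ht, -, rfl⟩ := D.common_end_of_mem_arcs _ he _ f.1.2 (Ne.symm f.2) _ hw hf
        exact hend t ht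
      · exact hend t (D.end_of_mem_arc _ he t hw)) hx (fun e => hxv ⟨u, e.symm⟩)
      (fun e => hxv ⟨v, e.symm⟩) (z := z) (hc ▸ hz)
    rw [← hc] at key
    intro w hw
    rcases Sym2.mem_iff.1 hw with rfl | rfl
    exacts [key harc.left_mem, key harc.symm.left_mem]

theorem isPlanar_sup_edge {u v : V} (huv : u ≠ v) {A : Set Plane}
    (hA : IsArc (D.point u) (D.point v) A)
    (hAD : ∀ x ∈ A, x ∈ D.carrier → x = D.point u ∨ x = D.point v) :
    IsPlanar (G ⊔ SimpleGraph.edge u v) := by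
  classical
  have hedge : ∀ e, e ∈ (G ⊔ SimpleGraph.edge u v).edgeSet → e ≠ s(u, v) → e ∈ G.edgeSet := by
    intro e he hne
    induction e using Sym2.ind with
    | _ a b =>
      rw [SimpleGraph.mem_edgeSet, SimpleGraph.sup_adj, SimpleGraph.edge_adj] at he
      rcases he with he | ⟨he, -⟩
      · exact he
      · exact absurd (Sym2.eq_iff.2 he) hne
  have hend : ∀ x ∈ A, x ∈ D.carrier → ∃ w ∈ s(u, v), D.point w = x := by
    intro x hx hxD
    rcases hAD x hx hxD with rfl | rfl
    exacts [⟨u, Sym2.mem_mk_left _ _, rfl⟩, ⟨v, Sym2.mem_mk_right _ _, rfl⟩]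
  have hcommon : ∀ f ∈ G.edgeSet, ∀ x ∈ A, x ∈ D.arc f →
      ∃ w, w ∈ s(u, v) ∧ w ∈ f ∧ D.point w = x := by
    intro f hf x hx hxf
    obtain ⟨w, hw, rfl⟩ := hend x hx (arc_subset_carrier hf hxf)
    exact ⟨w, hw, D.end_of_mem_arc f hf w hxf, rfl⟩
  refine ⟨⟨D.point, fun e => if e = s(u, v) then A else D.arc e, D.point_injective, ?_, ?_, ?_⟩⟩
  · intro a b hab
    by_cases h : s(a, b) = s(u, v)
    · rw [if_pos h]
      rcases Sym2.eq_iff.1 h with ⟨rfl, rfl⟩ | ⟨rfl, rfl⟩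
      exacts [hA, hA.symm]
    · rw [if_neg h]
      exact D.isArc a b (hedge _ hab h)
  · intro e he w hw
    by_cases h : e = s(u, v)
    · rw [if_pos h] at hw
      obtain ⟨t, ht, hte⟩ := hend _ hw (point_mem_carrier w)
      rw [h, ← D.point_injective hte]
      exact ht
    · rw [if_neg h] at hw
      exact D.end_of_mem_arc e (hedge e he h) w hw
  · intro e he f hf hef x hxe hxf
    by_cases h : e = s(u, v)
    · have hf' : f ≠ s(u, v) := fun h' => hef (h.trans h'.symm)
      rw [if_pos h] at hxe
      rw [if_neg hf'] at hxf
      rw [h]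
      exact hcommon f (hedge f hf hf') x hxe hxf
    · rw [if_neg h] at hxe
      by_cases h' : f = s(u, v)
      · rw [if_pos h'] at hxf
        obtain ⟨w, h1, h2, h3⟩ := hcommon e (hedge e he h) x hxf hxe
        exact ⟨w, h2, h' ▸ h1, h3⟩
      · rw [if_neg h'] at hxf
        exact D.common_end_of_mem_arcs e (hedge e he h) f (hedge f hf h') hef x hxe hxf

/-- In a maximal planar graph, two distinct vertices on a common face are adjacent. -/
theorem adj_of_mem_closure_face [Finite V] (hG : IsMaximalPlanar G) {u v : V} (huv : u ≠ v)
    {z : Plane} (hu : D.point u ∈ closure (face D.carrier z))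
    (hv : D.point v ∈ closure (face D.carrier z)) : G.Adj u v := by
  by_contra hn
  have hX := D.isPolygonal_carrier
  have hnot : ∀ w : V, D.point w ∉ face D.carrier z := fun w h => face_subset h (point_mem_carrier w)
  have hvis : ∀ {x q : Plane}, (∀ t ∈ Ioc (0 : ℝ) 1, lineMap x q t ∈ face D.carrier z) →
      ∀ w ∈ segment ℝ x q, w ≠ x → w ∈ face D.carrier z := by
    intro x q h w hw hwx
    rw [segment_eq_image_lineMap] at hw
    obtain ⟨t, ht, rfl⟩ := hw
    refine h t ⟨lt_of_le_of_ne ht.1 ?_, ht.2⟩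
    rintro rfl
    exact hwx (lineMap_apply_zero _ _)
  -- Leave each vertex straight into the face and connect within it; the resulting arc would be a
  -- drawing of the missing edge.
  obtain ⟨p, hp, -, hup⟩ := hX.exists_visible hu one_pos
  obtain ⟨q, hq, -, hvq⟩ := hX.exists_visible hv one_pos
  obtain ⟨A, hA, hAU⟩ := exists_isArc_of_isOpen (isOpen_face hX.isClosed) isPreconnected_face
    (hnot v) (fun h => huv (D.point_injective h)) hp hq (hvis hup) (hvis hvq)
  exact hG.2 u v huv hn (isPlanar_sup_edge huv hA fun x hx hxD =>
    (hAU x hx).resolve_left fun h => face_subset h hxD)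

end PlaneDrawing

end MaxPlanar

namespace MaxPlanar

/-! ### Small cliques do not separate, and edges lie in triangles -/

open Metric Set AffineMap

namespace PlaneDrawing

variable {V : Type*} {G : SimpleGraph V} (D : PlaneDrawing G)

/-- The point `x` of the drawing is the vertex `v` or an inner point of an edge at `v`. -/
def Marks (v : V) (x : Plane) : Prop :=
  x = D.point v ∨ x ∉ range D.point ∧ ∃ e ∈ G.edgeSet, v ∈ e ∧ x ∈ D.arc e

variable {D}

theorem Marks.mem_closure_face [Finite V] {v : V} {x z : Plane} (h : D.Marks v x)
    (hx : x ∈ closure (face D.carrier z)) : D.point v ∈ closure (face D.carrier z) := by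
  rcases h with rfl | ⟨hxv, e, he, hve, hxe⟩
  · exact hx
  · exact mem_closure_face_of_mem_arc he hxe hxv hx v hve

theorem marks_of_mem_arc {u v : V} (huv : G.Adj u v) {x : Plane} (hx : x ∈ D.arc s(u, v))
    (hxu : x ≠ D.point u) (hxv : x ≠ D.point v) : D.Marks u x ∧ D.Marks v x := by
  have hr : x ∉ range D.point := by
    rintro ⟨w, rfl⟩
    rcases Sym2.mem_iff.1 (D.end_of_mem_arc _ huv w hx) with rfl | rfl
    exacts [hxu rfl, hxv rfl]
  exact ⟨Or.inr ⟨hr, _, huv, Sym2.mem_mk_left _ _, hx⟩,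
    Or.inr ⟨hr, _, huv, Sym2.mem_mk_right _ _, hx⟩⟩

theorem marks_or_of_mem_carrier {x : Plane} (hx : x ∈ D.carrier) :
    (∃ v, x = D.point v) ∨
      ∃ u v, G.Adj u v ∧ x ∈ D.arc s(u, v) ∧ D.Marks u x ∧ D.Marks v x := by
  by_cases hr : x ∈ range D.point
  · obtain ⟨v, rfl⟩ := hr
    exact Or.inl ⟨v, rfl⟩
  · obtain ⟨⟨e, he⟩, hxe⟩ := mem_iUnion.1 (hx.resolve_right hr)
    induction e using Sym2.ind with
    | _ u v =>
      exact Or.inr ⟨u, v, he, hxe, marks_of_mem_arc he hxe (fun h => hr ⟨u, h.symm⟩)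
        (fun h => hr ⟨v, h.symm⟩)⟩

/-- In a maximal planar graph, a connected set of points avoiding the drawing of the subgraph
induced by `C` cannot meet two parts separated by `C`. -/
theorem exists_adj_of_isPreconnected [Finite V] (hG : IsMaximalPlanar G) {C S : Set V}
    {Q : Set Plane} (hQ : IsPreconnected Q) (hQC : ∀ v ∈ C, D.point v ∉ Q)
    (hQe : ∀ u ∈ C, ∀ v ∈ C, G.Adj u v → ∀ x ∈ Q, x ∉ D.arc s(u, v))
    {s r : V} (hs : s ∈ S) (hr : r ∉ S) (hrC : r ∉ C) {x y : Plane} (hx : x ∈ Q) (hy : y ∈ Q)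
    (hsx : D.Marks s x) (hry : D.Marks r y) : ∃ u ∈ S, ∃ v ∉ S, v ∉ C ∧ G.Adj u v := by
  by_contra! hn
  have hX := D.isPolygonal_carrier
  -- Without an edge from `S` to the far side, no face touches both. So the property "touches `S`"
  -- is decided at each drawing point of `Q` by a vertex outside `C` that it marks.
  have hface : ∀ v ∉ S, v ∉ C → ∀ z, D.point v ∈ closure (face D.carrier z) →
      ¬ ∃ u ∈ S, D.point u ∈ closure (face D.carrier z) := by
    rintro v hv hvC z hvz ⟨u, hu, huz⟩
    exact hn u hu v hv hvC (adj_of_mem_closure_face hG (fun e => hv (e ▸ hu)) huz hvz)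
  obtain ⟨z, hz, hxz⟩ := hX.exists_mem_closure_face x
  obtain ⟨z', hz', hyz⟩ := hX.exists_mem_closure_face y
  refine hface r hr hrC z' (hry.mem_closure_face hyz) (hX.face_property_constant hQ
    (fun z => ∃ u ∈ S, D.point u ∈ closure (face D.carrier z)) (fun y z h => by simp only [h, imp_self])
    (fun w hw hwX => ?_) hx hy hz hz' hxz hyz ⟨s, hs, hsx.mem_closure_face hxz⟩)
  obtain ⟨v, hvC, hv⟩ : ∃ v ∉ C, D.Marks v w := by
    rcases marks_or_of_mem_carrier hwX with ⟨v, rfl⟩ | ⟨u, v, huv, hw', hu, hv⟩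
    · exact ⟨v, fun h => hQC v h hw, Or.inl rfl⟩
    · by_cases huC : u ∈ C
      · exact ⟨v, fun hvC => hQe u huC v hvC huv w hw hw', hv⟩
      · exact ⟨u, huC, hu⟩
  by_cases hvS : v ∈ S
  · exact Or.inl fun z _ hwz => ⟨v, hvS, hv.mem_closure_face hwz⟩
  · exact Or.inr fun z _ hwz => hface v hvS hvC z (hv.mem_closure_face hwz)

end PlaneDrawing

theorem isPreconnected_compl_finite {s : Set Plane} (hs : s.Finite) : IsPreconnected sᶜ := by
  refine (hs.countable.isConnected_compl_of_one_lt_rank ?_).isPreconnected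
  rw [← Module.finrank_eq_rank, finrank_euclideanSpace_fin]
  norm_num

namespace IsMaximalPlanar

variable {V : Type*} [Finite V] {G : SimpleGraph V}

theorem exists_adj_of_subsingleton (hG : IsMaximalPlanar G) {C S : Set V} (hC : C.Subsingleton)
    (hSC : Disjoint S C) {s r : V} (hs : s ∈ S) (hr : r ∉ S) (hrC : r ∉ C) :
    ∃ u ∈ S, ∃ v ∉ S, v ∉ C ∧ G.Adj u v := by
  obtain ⟨D⟩ := hG.1
  have hmem : ∀ v ∉ C, D.point v ∈ (D.point '' C)ᶜ := by
    rintro v hv ⟨w, hw, e⟩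
    exact hv (D.point_injective e ▸ hw)
  exact PlaneDrawing.exists_adj_of_isPreconnected (D := D) hG
    (isPreconnected_compl_finite (hC.finite.image D.point))
    (fun v hv h => h ⟨v, hv, rfl⟩) (fun u hu v hv huv => absurd (hC hu hv) huv.ne) hs hr hrC
    (hmem s (disjoint_left.1 hSC hs)) (hmem r hrC) (Or.inl rfl) (Or.inl rfl)

theorem exists_adj_of_pair (hG : IsMaximalPlanar G) {a b : V} {S : Set V} (hab : G.Adj a b)
    (ha : a ∉ S) (hb : b ∉ S) {s r : V} (hs : s ∈ S) (hr : r ∉ S) (hra : r ≠ a) (hrb : r ≠ b) :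
    ∃ u ∈ S, ∃ v ∉ S, v ∉ ({a, b} : Set V) ∧ G.Adj u v := by
  -- If `a` has neighbours on both sides, the edges to them can be compared in a small disc around
  -- `a` cut along the edge `ab`. Otherwise `a` can be assigned to a side where it creates no new
  -- crossing edge, which leaves only `b` to be removed.
  by_cases haS : ∃ u ∈ S, G.Adj a u
  · by_cases haR : ∃ v ∉ S, v ≠ b ∧ G.Adj a v
    · obtain ⟨u, hu, hau⟩ := haS
      obtain ⟨v, hv, hvb, hav⟩ := haR
      obtain ⟨D⟩ := hG.1
      obtain ⟨ε, hε, hpre⟩ := (D.isArc a b hab).exists_isPreconnected_ball_diff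
      have hmark : ∀ w, w ≠ b → G.Adj a w →
          ∃ x ∈ ball (D.point a) ε \ D.arc s(a, b), D.Marks w x := by
        intro w hwb haw
        obtain ⟨x, hx, hxb, hxa, hxw⟩ := (D.isArc a w haw).exists_mem_ball hε
        refine ⟨x, ⟨hxb, fun hxab => ?_⟩, (PlaneDrawing.marks_of_mem_arc haw hx hxa hxw).2⟩
        obtain ⟨t, ht, -, rfl⟩ := D.common_end_of_mem_arcs _ haw _ hab
          (fun h => hwb (Sym2.congr_right.1 h)) x hx hxab
        rcases Sym2.mem_iff.1 ht with rfl | rfl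
        exacts [hxa rfl, hxw rfl]
      obtain ⟨x, hx, hux⟩ := hmark u (fun h => hb (h ▸ hu)) hau
      obtain ⟨y, hy, hvy⟩ := hmark v hvb hav
      refine PlaneDrawing.exists_adj_of_isPreconnected (D := D) hG hpre ?_ ?_ hu hv
        (by rintro (h | h); exacts [hav.ne h.symm, hvb h]) hx hy hux hvy
      · rintro w (rfl | rfl) h
        · exact h.2 (D.isArc _ b hab).left_mem
        · exact h.2 (D.isArc a _ hab).symm.left_mem
      · rintro w (rfl | rfl) w' (rfl | rfl) hww x hx hxa
        · exact hww.ne rfl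
        · exact hx.2 hxa
        · exact hx.2 (Sym2.eq_swap ▸ hxa)
        · exact hww.ne rfl
    · push Not at haR
      obtain ⟨u, hu, v, hv, hvb, huv⟩ := hG.exists_adj_of_subsingleton (C := {b}) (S := insert a S)
        subsingleton_singleton (by
          rw [disjoint_singleton_right]; rintro (h | h); exacts [hab.ne h.symm, hb h])
        (Or.inr hs) (r := r) (by rintro (h | h); exacts [hra h, hr h]) hrb
      have hva : v ≠ a := fun h => hv (Or.inl h)
      have hvS : v ∉ S := fun h => hv (Or.inr h)
      rcases hu with rfl | hu
      · exact absurd huv (haR v hvS hvb)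
      · exact ⟨u, hu, v, hvS, by rintro (h | h); exacts [hva h, hvb h], huv⟩
  · push Not at haS
    obtain ⟨u, hu, v, hv, hvb, huv⟩ := hG.exists_adj_of_subsingleton (C := {b}) (S := S)
      subsingleton_singleton (disjoint_singleton_right.2 hb) hs hr hrb
    refine ⟨u, hu, v, hv, ?_, huv⟩
    rintro (rfl | h)
    · exact haS u hu huv.symm
    · exact hvb h

/-- A clique on at most two vertices does not separate a maximal planar graph. -/
theorem exists_adj_of_isClique (hG : IsMaximalPlanar G) {C : Finset V} {S : Set V}
    (hC : G.IsClique C) (hC2 : C.card ≤ 2) (hSC : ∀ c ∈ C, c ∉ S) {s r : V} (hs : s ∈ S)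
    (hr : r ∉ S) (hrC : r ∉ C) : ∃ u ∈ S, ∃ v ∉ S, v ∉ C ∧ G.Adj u v := by
  classical
  rcases hC2.eq_or_lt with h2 | h1
  · obtain ⟨a, b, hab, rfl⟩ := Finset.card_eq_two.1 h2
    simp only [Finset.mem_insert, Finset.mem_singleton, not_or] at hSC hrC
    obtain ⟨u, hu, v, hv, hvC, huv⟩ := hG.exists_adj_of_pair (hC (by simp) (by simp) hab)
      (hSC a (Or.inl rfl)) (hSC b (Or.inr rfl)) hs hr hrC.1 hrC.2
    exact ⟨u, hu, v, hv, by simpa using hvC, huv⟩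
  · exact hG.exists_adj_of_subsingleton (C := C) (fun a ha b hb =>
      Finset.card_le_one.1 (Nat.lt_succ_iff.1 h1) a ha b hb)
      (disjoint_right.2 hSC) hs hr hrC

/-- Every edge of a maximal planar graph on at least three vertices lies in a triangle. -/
theorem exists_common_neighbor (hG : IsMaximalPlanar G) {a b v : V} (hab : G.Adj a b)
    (hva : v ≠ a) (hvb : v ≠ b) : ∃ t, G.Adj a t ∧ G.Adj b t := by
  by_contra! hn
  obtain ⟨D⟩ := hG.1
  have hX := D.isPolygonal_carrier
  have hface : ∀ z, D.point a ∈ closure (face D.carrier z) →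
      D.point b ∈ closure (face D.carrier z) →
      ¬ ∃ u, u ≠ a ∧ u ≠ b ∧ D.point u ∈ closure (face D.carrier z) := by
    rintro z haz hbz ⟨u, hua, hub, huz⟩
    exact hn u (PlaneDrawing.adj_of_mem_closure_face hG hua.symm haz huz)
      (PlaneDrawing.adj_of_mem_closure_face hG hub.symm hbz huz)
  obtain ⟨y, hy, -, hya, hyb⟩ := (D.isArc a b hab).exists_mem_ball one_pos
  have hmark := PlaneDrawing.marks_of_mem_arc hab hy hya hyb
  obtain ⟨z, hz, hvz⟩ := hX.exists_mem_closure_face (D.point v)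
  obtain ⟨z', hz', hyz⟩ := hX.exists_mem_closure_face y
  -- The property "touches a third vertex" is followed from `v` to the inner point `y` of the edge
  -- `ab`, in the plane minus the two ends. Inside this edge every face lacks it, and at all other
  -- points of the drawing every face has it.
  refine hface z' (hmark.1.mem_closure_face hyz) (hmark.2.mem_closure_face hyz)
    (hX.face_property_constant
    (isPreconnected_compl_finite (Set.toFinite {D.point a, D.point b}))
    (fun z => ∃ u, u ≠ a ∧ u ≠ b ∧ D.point u ∈ closure (face D.carrier z))
    (fun y z h => by simp only [h, imp_self]) (fun w hw hwX => ?_)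
    (x := D.point v) (y := y) ?_ ?_ hz hz' hvz hyz ⟨v, hva, hvb, hvz⟩)
  · have hout : ∀ u, u ≠ a → u ≠ b → D.Marks u w → ∀ z ∉ D.carrier,
        w ∈ closure (face D.carrier z) →
        ∃ u, u ≠ a ∧ u ≠ b ∧ D.point u ∈ closure (face D.carrier z) :=
      fun u hua hub hu z _ hwz => ⟨u, hua, hub, hu.mem_closure_face hwz⟩
    rcases PlaneDrawing.marks_or_of_mem_carrier hwX with ⟨u, rfl⟩ | ⟨u, t, hut, -, hu, ht⟩
    · exact Or.inl (hout u (fun h => hw (Or.inl (h ▸ rfl))) (fun h => hw (Or.inr (h ▸ rfl)))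
        (Or.inl rfl))
    · by_cases h1 : u ≠ a ∧ u ≠ b
      · exact Or.inl (hout u h1.1 h1.2 hu)
      by_cases h2 : t ≠ a ∧ t ≠ b
      · exact Or.inl (hout t h2.1 h2.2 ht)
      have hne := hut.ne
      obtain ⟨ha, hb⟩ : D.Marks a w ∧ D.Marks b w := by
        rw [not_and_or, not_not, not_not] at h1 h2
        rcases h1 with rfl | rfl <;> rcases h2 with rfl | rfl
        exacts [absurd rfl hne, ⟨hu, ht⟩, ⟨ht, hu⟩, absurd rfl hne]
      exact Or.inr fun z _ hwz => hface z (ha.mem_closure_face hwz) (hb.mem_closure_face hwz)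
  · rintro (h | h)
    exacts [hva (D.point_injective h), hvb (D.point_injective h)]
  · rintro (h | h)
    exacts [hya h, hyb h]

end IsMaximalPlanar

end MaxPlanar

namespace MaxPlanar

/-! ### Separating triangles and the order on 3-cliques -/

section Combinatorics

variable {V : Type*} [Fintype V] [DecidableEq V] {G : SimpleGraph V}

namespace Divides

variable {C S S' : Finset V}

theorem symm (h : Divides G C S S') : Divides G C S' S where
  disjoint := h.disjoint.symm
  union_eq := by rw [Finset.union_comm, h.union_eq]
  path_meets i hi j hj p hp := by
    obtain ⟨c, hc, hcp⟩ := h.path_meets j hj i hi p.reverse hp.reverse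
    exact ⟨c, hc, by simpa using hcp⟩

theorem mem_or_mem (h : Divides G C S S') {v : V} (hv : v ∉ C) : v ∈ S ∨ v ∈ S' := by
  rw [← Finset.mem_union, h.union_eq, Finset.mem_compl]; exact hv

theorem notMem_of_mem_left (h : Divides G C S S') {v : V} (hv : v ∈ S) : v ∉ C := by
  rw [← Finset.mem_compl, ← h.union_eq]; exact Finset.mem_union_left _ hv

theorem notMem_of_mem_right (h : Divides G C S S') {v : V} (hv : v ∈ S') : v ∉ C :=
  h.symm.notMem_of_mem_left hv

theorem not_adj (h : Divides G C S S') {u v : V} (hu : u ∈ S) (hv : v ∈ S') : ¬ G.Adj u v := by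
  intro huv
  obtain ⟨c, hc, hcp⟩ := h.path_meets u hu v hv (SimpleGraph.Walk.cons huv .nil)
    (by simp [huv.ne])
  have : c = u ∨ c = v := by simpa using hcp
  rcases this with rfl | rfl
  exacts [h.notMem_of_mem_left hu hc, h.notMem_of_mem_right hv hc]

theorem union_eq_compl (h : Divides G C S S') : C ∪ S = S'ᶜ := by
  ext v
  rw [Finset.mem_union, Finset.mem_compl]
  constructor
  · rintro (hv | hv) hv'
    exacts [h.notMem_of_mem_right hv' hv, Finset.disjoint_left.1 h.disjoint hv hv']
  · intro hv
    by_cases hC : v ∈ C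
    exacts [Or.inl hC, Or.inr ((h.mem_or_mem hC).resolve_right hv)]

/-- Every vertex of a separating triangle has a neighbour on both sides. -/
theorem exists_adj_left (hG : IsMaximalPlanar G) (h : Divides G C S S') (hC : G.IsNClique 3 C)
    (hS : S.Nonempty) {c : V} (hc : c ∈ C) : ∃ s ∈ S, G.Adj c s := by
  by_contra! hn
  obtain ⟨s, hs⟩ := hS
  -- If `c` had no neighbour in `S`, the other two vertices of `C` would already separate `S` from
  -- `c`.
  obtain ⟨u, hu, v, hv, hvC, huv⟩ := hG.exists_adj_of_isClique (C := C.erase c) (S := S)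
    (hC.isClique.subset (Finset.coe_subset.2 (Finset.erase_subset _ _)))
    (by rw [Finset.card_erase_of_mem hc, hC.card_eq])
    (fun d hd hdS => h.notMem_of_mem_left hdS (Finset.mem_of_mem_erase hd)) hs
    (r := c) (fun hcS => h.notMem_of_mem_left hcS hc) (Finset.notMem_erase _ _)
  by_cases hvc : v = c
  · exact hn u hu (hvc ▸ huv.symm)
  · have hvC' : v ∉ C := fun h' => hvC (Finset.mem_erase.2 ⟨hvc, h'⟩)
    exact h.not_adj hu ((h.mem_or_mem hvC').resolve_left hv) huv

/-- If a triangle `L` lies in `C ∪ S` and a vertex of `C` lies in the part `T` of the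
complement of `L`, then `S'` lies in `T` as well. -/
theorem subset_of_subset_union (hG : IsMaximalPlanar G) (h : Divides G C S S')
    (hC : G.IsNClique 3 C) {L T T' : Finset V} (hL : Divides G L T T') (hLC : L ⊆ C ∪ S)
    {c : V} (hc : c ∈ C) (hcT : c ∈ T) : S' ⊆ T ∧ C \ L ⊆ T := by
  have hLS' : ∀ v ∈ S', v ∉ L := fun v hv hvL => by
    have := hLC hvL
    rw [h.union_eq_compl, Finset.mem_compl] at this
    exact this hv
  have hCT : C \ L ⊆ T := by
    intro d hd
    rw [Finset.mem_sdiff] at hd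
    by_contra hdT
    have hdT' := (hL.mem_or_mem hd.2).resolve_left hdT
    exact hL.not_adj hcT hdT' (hC.isClique hc hd.1 fun e => hdT (e ▸ hcT))
  refine ⟨?_, hCT⟩
  intro s hs
  by_contra hsT
  have hsT' := (hL.mem_or_mem (hLS' s hs)).resolve_left hsT
  have hcL : c ∉ L := hL.notMem_of_mem_left hcT
  have hdisj := Finset.disjoint_left.1 hL.disjoint
  -- A vertex of `S' ∩ T'` would be cut off from `c` by `C ∩ L`, a clique on at most two vertices
  -- since `c ∉ L`.
  obtain ⟨u, ⟨hu, huT⟩, v, hv, hvC, huv⟩ := hG.exists_adj_of_isClique (C := C.erase c ∩ L)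
    (S := {v | v ∈ S' ∧ v ∈ T'})
    (hC.isClique.subset (Finset.coe_subset.2
      (Finset.inter_subset_left.trans (Finset.erase_subset _ _))))
    ((Finset.card_le_card Finset.inter_subset_left).trans
      (by rw [Finset.card_erase_of_mem hc, hC.card_eq]))
    (fun d hd hd' => hLS' d hd'.1 (Finset.mem_inter.1 hd).2) (s := s) ⟨hs, hsT'⟩ (r := c)
    (fun hc' => hdisj hcT hc'.2) (fun hc' => hcL (Finset.mem_inter.1 hc').2)
  have hvT : v ∉ T := fun hvT => hL.not_adj hvT huT huv.symm
  have hvS : v ∉ S := fun hvS => h.not_adj hvS hu huv.symm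
  by_cases hvL : v ∈ L
  · have hvC' : v ∈ C := (Finset.mem_union.1 (hLC hvL)).resolve_right hvS
    exact hvC (Finset.mem_inter.2 ⟨Finset.mem_erase.2 ⟨fun e => hcL (e ▸ hvL), hvC'⟩, hvL⟩)
  · have hvT' := (hL.mem_or_mem hvL).resolve_left hvT
    have hvC' : v ∉ C := fun hvC' => hvT (hCT (Finset.mem_sdiff.2 ⟨hvC', hvL⟩))
    exact hv ⟨(h.mem_or_mem hvC').resolve_left hvS, hvT'⟩

end Divides

namespace Orientation

variable (O : Orientation G)

theorem interior_eq_empty {k : ThreeClique G} (hk : ¬ IsSeparating G k.1) : O.interior k = ∅ := by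
  by_contra hn
  have hi := Finset.nonempty_iff_ne_empty.2 hn
  exact hk ⟨_, _, hi, Finset.card_pos.1 ((Finset.card_pos.2 hi).trans_le (O.card_le_card k)),
    O.divides k⟩

/-- The exteriors agree, being complements. Every vertex of `k` has a neighbour in this common
exterior, so it cannot be interior to `l` and must belong to `l`. -/
theorem eq_of_union_interior_eq (hG : IsMaximalPlanar G) {k l : ThreeClique G}
    (hk : (O.interior k).Nonempty) (h : k.1 ∪ O.interior k = l.1 ∪ O.interior l) : k = l := by
  have hout : O.exterior k = O.exterior l := by
    rw [(O.divides k).union_eq_compl, (O.divides l).union_eq_compl] at h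
    exact compl_injective h
  have hne : (O.exterior k).Nonempty :=
    Finset.card_pos.1 ((Finset.card_pos.2 hk).trans_le (O.card_le_card k))
  refine Subtype.ext (Finset.eq_of_subset_of_card_le (fun c hc => ?_)
    (by rw [k.2.card_eq, l.2.card_eq]))
  obtain ⟨s, hs, hcs⟩ := (O.divides k).symm.exists_adj_left hG k.2 hne hc
  have hcl := Finset.mem_union_left (O.interior k) hc
  rw [h] at hcl
  rcases Finset.mem_union.1 hcl with hcl | hcl
  · exact hcl
  · exact absurd hcs ((O.divides l).not_adj hcl (hout ▸ hs))

theorem le_of_subset (hG : IsMaximalPlanar G) {k l : ThreeClique G} (hlk : l ≠ k)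
    (h : l.1 ⊆ k.1 ∪ O.interior k) : O.Le l k := by
  have hk := O.divides k
  have hl := O.divides l
  obtain ⟨c, hck, hcl⟩ : ∃ c ∈ k.1, c ∉ l.1 := Finset.not_subset.1 fun hs =>
    hlk (Subtype.ext (Finset.eq_of_subset_of_card_le hs (by rw [k.2.card_eq, l.2.card_eq]))).symm
  -- The exterior of `k` lies on the side of `l` that contains `c`. If this were the interior of
  -- `l`, then |ext k| < |int l| ≤ |ext l| ≤ |int k| ≤ |ext k|. So it is the exterior, and taking
  -- complements gives the claim.
  rcases hl.mem_or_mem hcl with hc | hc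
  · exfalso
    obtain ⟨h1, h2⟩ := hk.subset_of_subset_union hG k.2 hl h hck hc
    have hlt : (O.exterior k).card < (O.interior l).card :=
      Finset.card_lt_card ⟨h1, fun hs => hk.notMem_of_mem_right (hs hc) hck⟩
    have hsub : O.exterior l ⊆ O.interior k := by
      intro v hv
      have hvi : v ∉ O.interior l := fun hvi => Finset.disjoint_left.1 hl.disjoint hvi hv
      have hvk : v ∉ k.1 := fun hvk =>
        hvi (h2 (Finset.mem_sdiff.2 ⟨hvk, hl.notMem_of_mem_right hv⟩))
      exact (hk.mem_or_mem hvk).resolve_right fun hve => hvi (h1 hve)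
    have := Finset.card_le_card hsub
    have := O.card_le_card k
    have := O.card_le_card l
    omega
  · obtain ⟨h1, -⟩ := hk.subset_of_subset_union hG k.2 hl.symm h hck hc
    rw [Le, hl.union_eq_compl, hk.union_eq_compl]
    exact Finset.compl_subset_compl.2 h1

theorem exists_le_ne (hG : IsMaximalPlanar G) {k : ThreeClique G}
    (hk : (O.interior k).Nonempty) : ∃ l, l ≠ k ∧ O.Le l k := by
  have hd := O.divides k
  obtain ⟨a, b, c, hab, hac, hbc, hkabc⟩ := SimpleGraph.is3Clique_iff.1 k.2
  have hak : a ∈ k.1 := by rw [hkabc]; simp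
  have hbk : b ∈ k.1 := by rw [hkabc]; simp
  obtain ⟨s, hs, has⟩ := hd.exists_adj_left hG k.2 hk hak
  have hsk := hd.notMem_of_mem_left hs
  -- The vertex `b` of `k` only serves as the third vertex which guarantees that the edge `as` lies
  -- in a triangle.
  obtain ⟨t, hat, hst⟩ := hG.exists_common_neighbor has hab.ne' fun e => hsk (e ▸ hbk)
  have ht : t ∈ k.1 ∪ O.interior k := by
    rw [hd.union_eq_compl, Finset.mem_compl]
    exact fun ht => hd.not_adj hs ht hst
  refine ⟨⟨{a, s, t}, SimpleGraph.is3Clique_triple_iff.2 ⟨has, hat, hst⟩⟩, ?_, ?_⟩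
  · rintro rfl
    exact hsk (by simp)
  · refine O.le_of_subset hG ?_ ?_
    · rintro rfl
      exact hsk (by simp)
    · intro v hv
      simp only [Finset.mem_insert, Finset.mem_singleton] at hv
      rcases hv with rfl | rfl | rfl
      exacts [Finset.mem_union_left _ hak, Finset.mem_union_right _ hs, ht]

theorem eq_of_le_of_card_le (hG : IsMaximalPlanar G) {k l : ThreeClique G} (h : O.Le k l)
    (hc : (l.1 ∪ O.interior l).card ≤ (k.1 ∪ O.interior k).card) : l = k := by
  have heq := Finset.eq_of_subset_of_card_le h hc
  by_cases hk : (O.interior k).Nonempty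
  · exact (O.eq_of_union_interior_eq hG hk heq).symm
  · rw [Finset.not_nonempty_iff_eq_empty.1 hk, Finset.union_empty] at heq
    exact Subtype.ext (Finset.eq_of_subset_of_card_le
      (heq ▸ Finset.subset_union_left) (by rw [k.2.card_eq, l.2.card_eq]))

end Orientation

end Combinatorics

end MaxPlanar

theorem mainTheorem10 {V : Type*} [Fintype V] [DecidableEq V] (G : SimpleGraph V)
    (hG : MaxPlanar.IsMaximalPlanar G) (O : MaxPlanar.Orientation G)
    (k : MaxPlanar.ThreeClique G) :
    MaxPlanar.IsSeparating G k.1 ↔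
      (MaxPlanar.incomingNeighbors O.hierarchicalGraph k).Nonempty := by
  constructor
  · intro hk
    -- Maximal cardinality suffices for covering: a 3-clique between `l` and `k` other than `k` has
    -- a union no larger than that of `l`, hence equals `l`.
    obtain ⟨l, ⟨hlk, hle⟩, hmax⟩ := Set.Finite.exists_maximalFor
      (fun l : MaxPlanar.ThreeClique G => (l.1 ∪ O.interior l).card) {l | l ≠ k ∧ O.Le l k}
      (Set.toFinite _) (O.exists_le_ne hG (O.nonempty_of_isSeparating k hk).1)
    refine ⟨l, hle, hlk, fun m hlm hmk => or_iff_not_imp_right.2 fun hm => ?_⟩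
    exact O.eq_of_le_of_card_le hG hlm (hmax ⟨hm, hmk⟩ (Finset.card_le_card hlm))
  · rintro ⟨l, hle, hlk, -⟩
    by_contra hk
    unfold MaxPlanar.Orientation.Le at hle
    rw [O.interior_eq_empty hk, Finset.union_empty] at hle
    exact hlk (Subtype.ext (Finset.eq_of_subset_of_card_le
      (Finset.subset_union_left.trans hle) (by rw [k.2.card_eq, l.2.card_eq])))
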